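/- There exist constants $d\in\mathbb N$ and $\gamma>0$, a family of graphs $G_n=(V_n,E_n)$ ($n\ge 1$) with $|V_n|=n$, and charges $c_n\colon V_n\to\{0,1\}$ with $\bigoplus_{v\in V_n}c_n(v)=1$, such that every $G_n$ is an expander with these constants (every vertex has degree at most $d$, and for every $S\subseteq V_n$ with $|S|\le n/2$ at least $\gamma|S|$ edges join $S$ to $V_n\setminus S$), and such that the Tseitin formulas $F_n=\mathrm{Ts}_{G_n,c_n}$ satisfy the following. Here $\mathrm{Ts}_{G,c}$ is the CNF in the variables $x_e$ ($e\in E$) obtained by expanding each vertex constraint $\bigoplus_{e\ni v}x_e=c(v)$ into $2^{\deg v-1}$ clauses of width $\deg v$ (for an isolated vertex: into the empty clause if $c(v)=1$, and into no clause if $c(v)=0$). 1. Every resolution refutation of $F_n$ has at least $2^{\Omega(n)}$ clauses: there is $\delta>0$ such that, for all sufficiently large $n$, every resolution refutation of $F_n$ consists of at least $2^{\delta n}$ clauses. 2. Every Hitting refutation of $F_n$ has size $2^{n^{\Omega(1)}}$: there is $\varepsilon>0$ such that, for all sufficiently large $n$, every unsatisfiable hitting formula (a CNF in which any two clauses contain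 contrary literals) each of whose clauses contains a clause of $F_n$ has at least $2^{n^{\varepsilon}}$ clauses. 3. $F_n$ has a tree-like $\mathrm{Res}(\oplus)$ refutation of size polynomial in $n$. The lines of $\mathrm{Res}(\oplus)$ are $\oplus$-clauses, that is, disjunctions (sets) of linear equations over $\mathrm{GF}(2)$; the rules are resolution (from $C\vee(f=0)$ and $D\vee(f=1)$ derive $C\vee D$) and weakening (from $C$ derive any $\oplus$-clause semantically implied by $C$). 4. Consequently, $F_n$ has a $\mathrm{Hitting}(\oplus)$ refutation of size polynomial in $n$: an unsatisfiable conjunction of $\oplus$-clauses, no two of which have a common falsifying assignment, such that each contains, as a set of equations, a clause of $F_n$ (a literal being read as an equation $x=0$ or $x=1$). In 3 and 4 the size is the total length of all $\oplus$-clauses (one for each $\oplus$-clause, for each equation in it and for each occurrence of a variable); in particular the number of $\oplus$-clauses is polynomial in $n$. -/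

import Mathlib

namespace PC

/-! ### CNF formulas

Assignments are functions `a : V → ZMod 2`. The pair `(x, 1)` is the literal `x`, the pair `(x, 0)`
is the literal `¬ x`; so `(x, b)` holds under `a` iff `a x = b`, and `(x, b + 1)` is the literal
contrary to `(x, b)`. -/

/-- A clause: a finite set of literals, read as their disjunction. -/
abbrev Clause (V : Type*) := Finset (V × ZMod 2)

/-- A CNF formula: a finite set of clauses, read as their conjunction. -/
abbrev CNF (V : Type*) := Finset (Clause V)

/-- The assignment `a` falsifies every literal of `C`. -/
def Clause.Falsified {V : Type*} (C : Clause V) (a : V → ZMod 2) : Prop :=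
  ∀ l ∈ C, a l.1 ≠ l.2

/-- Every assignment falsifies some clause. -/
def CNF.Unsat {V : Type*} (F : CNF V) : Prop :=
  ∀ a : V → ZMod 2, ∃ C ∈ F, Clause.Falsified C a

/-! ### Resolution -/

/-- The resolution rule: from `C ∨ x` and `D ∨ ¬ x` derive `C ∨ D`. -/
def Resolvent {V : Type*} [DecidableEq V] (A B R : Clause V) : Prop :=
  ∃ (x : V) (C D : Clause V), A = insert (x, 1) C ∧ B = insert (x, 0) D ∧ R = C ∪ D

/-- The sequence of clauses `π 0, …, π (s - 1)` is a (dag-like) resolution refutation of `F`: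
every clause is in `F` or is the resolvent of two earlier clauses, and the empty clause occurs.
Its size is its number of clauses `s`. -/
def IsResRefutation {V : Type*} [DecidableEq V] (F : CNF V) {s : ℕ} (π : Fin s → Clause V) :
    Prop :=
  (∀ i, π i ∈ F ∨ ∃ j k, j < i ∧ k < i ∧ Resolvent (π j) (π k) (π i)) ∧ ∃ i, π i = ∅

/-! ### Hitting -/

/-- A hitting formula: every two of its clauses contain contrary literals. -/
def IsHitting {V : Type*} (H : CNF V) : Prop :=
  ∀ C ∈ H, ∀ D ∈ H, C ≠ D → ∃ (x : V) (b : ZMod 2), (x, b) ∈ C ∧ (x, b + 1) ∈ D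

/-- `H` is a Hitting refutation of `F`: an unsatisfiable hitting formula each of whose clauses
contains a clause of `F`. Its size is its number of clauses `H.card`. -/
def IsHittingRefutation {V : Type*} (F H : CNF V) : Prop :=
  IsHitting H ∧ CNF.Unsat H ∧ ∀ C ∈ H, ∃ C' ∈ F, C' ⊆ C

/-! ### Clauses of linear equations modulo two -/

/-- A `⊕`-clause: a finite set of linear equations over `GF(2)`, read as their disjunction.
The pair `(S, b)` is the equation `⊕_{x ∈ S} x = b`. -/
abbrev XorClause (V : Type*) := Finset (Finset V × ZMod 2)

/-- The assignment `a` falsifies every equation of `C`. -/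
def XorClause.Falsified {V : Type*} (C : XorClause V) (a : V → ZMod 2) : Prop :=
  ∀ q ∈ C, ∑ x ∈ q.1, a x ≠ q.2

/-- `C` semantically implies `D`: every assignment that satisfies `C` satisfies `D`. -/
def XorClause.Implies {V : Type*} (C D : XorClause V) : Prop :=
  ∀ a : V → ZMod 2, XorClause.Falsified D a → XorClause.Falsified C a

/-- The length of a `⊕`-clause: one for the clause, one for each of its equations, and one for each
occurrence of a variable in them. -/
def XorClause.length {V : Type*} (C : XorClause V) : ℕ :=
  1 + ∑ q ∈ C, (q.1.card + 1)

/-- An ordinary clause as a `⊕`-clause: the literal `(x, b)` becomes the equation `x = b`. -/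
def Clause.toXor {V : Type*} [DecidableEq V] (C : Clause V) : XorClause V :=
  C.image fun l => ({l.1}, l.2)

/-! ### Tree-like `Res(⊕)` -/

/-- `TreeResXor F C s`: there is a tree-like `Res(⊕)` derivation of the `⊕`-clause `C` from the
CNF `F`, the sum of the lengths of the `⊕`-clauses at the nodes of the tree being `s`. -/
inductive TreeResXor {V : Type*} [DecidableEq V] (F : CNF V) : XorClause V → ℕ → Prop
  | ax {C : Clause V} (hC : C ∈ F) : TreeResXor F C.toXor (XorClause.length C.toXor)
  | res {C D : XorClause V} {f : Finset V} {s t : ℕ}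
      (hC : TreeResXor F (insert (f, 0) C) s) (hD : TreeResXor F (insert (f, 1) D) t) :
      TreeResXor F (C ∪ D) (s + t + XorClause.length (C ∪ D))
  | weaken {C D : XorClause V} {s : ℕ} (hC : TreeResXor F C s) (hCD : XorClause.Implies C D) :
      TreeResXor F D (s + XorClause.length D)

/-! ### Hitting(`⊕`) -/

/-- `H` is a Hitting(`⊕`) refutation of the CNF `F`: a finite set of `⊕`-clauses, no two of which
have a common falsifying assignment, that is unsatisfiable and each of whose `⊕`-clauses contains
a clause of `F`. -/
def IsHittingXorRefutation {V : Type*} [DecidableEq V] (F : CNF V) (H : Finset (XorClause V)) :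
    Prop :=
  (∀ C ∈ H, ∀ D ∈ H, C ≠ D → ∀ a, ¬ (XorClause.Falsified C a ∧ XorClause.Falsified D a)) ∧
  (∀ a, ∃ C ∈ H, XorClause.Falsified C a) ∧
  ∀ C ∈ H, ∃ C' ∈ F, Clause.toXor C' ⊆ C

/-! ### Tseitin formulas on expanders -/

open Classical in
/-- The edges of `G` incident to `v`. -/
noncomputable def incident {V : Type*} [Fintype V] (G : SimpleGraph V) (v : V) :
    Finset G.edgeSet :=
  Finset.univ.filter fun e => v ∈ (e : Sym2 V)

open Classical in
/-- The Tseitin formula of `G` with charges `c`, in the variables `x_e` for the edges `e` of `G`.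
For every vertex `v` the constraint `⊕_{e ∋ v} x_e = c v` is expanded into clauses: for each set `T`
of edges at `v` whose number has parity different from `c v` there is the clause on all edges at
`v` that is falsified exactly when `T` is the set of edges at `v` with value `1`. -/
noncomputable def tseitin {V : Type*} [Fintype V] (G : SimpleGraph V) (c : V → ZMod 2) :
    CNF G.edgeSet :=
  Finset.univ.biUnion fun v =>
    ((incident G v).powerset.filter fun T => (T.card : ZMod 2) ≠ c v).image fun T =>
      (incident G v).image fun e => (e, if e ∈ T then 0 else 1)

open Classical in
/-- `G` has maximum degree at most `d` and edge expansion at least `γ`: for every set `S` of at most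
half of the vertices, at least `γ * |S|` edges leave `S`. -/
def IsExpander {V : Type*} [Fintype V] (G : SimpleGraph V) (d : ℕ) (γ : ℝ) : Prop :=
  (∀ v, G.degree v ≤ d) ∧
  ∀ S : Finset V, 2 * S.card ≤ Fintype.card V → γ * S.card ≤ (G.interedges S Sᶜ).card

end PC

/-! Both lower bounds go through resolution width. On an expander, every clause with a narrow
derivation follows from the parity constraints at at most n/4 vertices. A minimal set of supporting
vertices has all its boundary edges in the clause, so if it has at most n/2 vertices, expansion
bounds it by a multiple of the width. One resolution step at most doubles n/4 to n/2, and narrowness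
brings it back to n/4. The empty clause would then follow from no constraints at all
(`IsExpander.not_der_of_width_le`).

Small refutations become narrow by setting variables. In resolution one sets a literal occurring in
many wide clauses (`Der.width_of_size`, the Ben-Sasson–Wigderson argument). In a small Hitting
refutation counting yields a short clause; every other clause clashes with it, so one of its few
literals is contradicted by a large share of them (`IsHittingRefutation.width`). Only the branch
that shrinks the formula by a factor costs a unit of width (`Der.combine`), so logarithmically many
units, up to that factor, suffice.

For the upper bounds, a parity constraint is one linear query. Each edge is counted at two vertices
and the total charge is odd, so some constraint fails. Asking the constraints in vertex order until
one fails, and then the boundedly many edges there, is a short decision tree. Read upwards it is the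
`Res(⊕)` refutation (`exists_treeResXor`); its leaves form the Hitting(`⊕`) refutation
(`exists_hittingXor`).

The graphs are unions of 14 permutations, found by a union bound (`exists_isExpander`). -/

namespace PC

/-! ### From small refutations to narrow ones -/

section Width

variable {V : Type*} [DecidableEq V]

/-- `Der F P C`: the clause `C` has a resolution derivation (with weakening) from `F` all of whose
lines belong to `P`. -/
inductive Der (F : CNF V) (P : Set (Clause V)) : Clause V → Prop
  | ax {C D : Clause V} (hC : C ∈ F) (hCD : C ⊆ D) (hD : D ∈ P) : Der F P D
  | res {A B R : Clause V} (x : V) (hA : Der F P A) (hB : Der F P B)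
      (hAR : A ⊆ insert (x, 1) R) (hBR : B ⊆ insert (x, 0) R) (hR : R ∈ P) : Der F P R

/-- The formula obtained by setting `x` to `b`. -/
def restrict (F : CNF V) (x : V) (b : ZMod 2) : CNF V :=
  (F.filter fun C => (x, b) ∉ C).image fun C => C.erase (x, b + 1)

theorem mem_restrict {F : CNF V} {x : V} {b : ZMod 2} {D : Clause V} :
    D ∈ restrict F x b ↔ ∃ C ∈ F, (x, b) ∉ C ∧ C.erase (x, b + 1) = D := by
  simp [restrict, and_assoc]

theorem card_restrict_le (F : CNF V) (x : V) (b : ZMod 2) :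
    (restrict F x b).card ≤ (F.filter fun C => (x, b) ∉ C).card :=
  Finset.card_image_le

theorem zmod_two_add_one_add_one (b : ZMod 2) : b + 1 + 1 = b := by
  revert b; decide

theorem zmod_two_cases (b : ZMod 2) : b = 0 ∨ b = 1 := by
  revert b; decide

theorem zmod_two_ne_iff (a b : ZMod 2) : a ≠ b ↔ a = b + 1 := by
  revert a b; decide

theorem zmod_two_add_one_ne (b : ZMod 2) : b + 1 ≠ b := by
  revert b; decide

theorem Der.mono {F : CNF V} {P Q : Set (Clause V)} (hPQ : P ⊆ Q) {C : Clause V}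
    (h : Der F P C) : Der F Q C := by
  induction h with
  | ax hC hCD hD => exact .ax hC hCD (hPQ hD)
  | res x _ _ hAR hBR hR hA hB => exact .res x hA hB hAR hBR (hPQ hR)

theorem Der.resolve {F : CNF V} {P : Set (Clause V)} {A B R : Clause V} (x : V) (b : ZMod 2)
    (hA : Der F P A) (hB : Der F P B) (hAR : A ⊆ insert (x, b) R)
    (hBR : B ⊆ insert (x, b + 1) R) (hR : R ∈ P) : Der F P R := by
  have hb := zmod_two_cases b
  rcases hb with rfl | rfl
  · exact .res x hB hA (by simpa using hBR) hAR hR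
  · exact .res x hA hB hAR hBR hR

/-- A degenerate resolution step with both premises equal; the pivot is arbitrary. -/
theorem Der.weaken {F : CNF V} {P : Set (Clause V)} {A R : Clause V} (x : V)
    (hA : Der F P A) (hAR : A ⊆ R) (hR : R ∈ P) : Der F P R :=
  .res x hA hA (hAR.trans (Finset.subset_insert _ _)) (hAR.trans (Finset.subset_insert _ _)) hR

/-- Steps with another pivot survive line by line. A step with pivot `x` collapses to a weakening of
the premise that the restriction does not satisfy. -/
theorem Der.restriction {F P : CNF V} {C : Clause V} (h : Der F P C) (x : V) (b : ZMod 2)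
    (hC : (x, b) ∉ C) :
    Der (restrict F x b) (restrict P x b) (C.erase (x, b + 1)) := by
  induction h with
  | ax hC' hCD hD =>
    exact .ax (mem_restrict.2 ⟨_, hC', fun h => hC (hCD h), rfl⟩) (Finset.erase_subset_erase _ hCD)
      (mem_restrict.2 ⟨_, hD, hC, rfl⟩)
  | @res A B R y _ _ hAR hBR hR hA hB =>
    have hR' : R.erase (x, b + 1) ∈ (restrict P x b : Set (Clause V)) :=
      Finset.mem_coe.2 (mem_restrict.2 ⟨_, hR, hC, rfl⟩)
    have key : ∀ (A : Clause V) (c : ZMod 2), A ⊆ insert (y, c) R → (y, c) ≠ (x, b) →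
        (x, b) ∉ A ∧ A.erase (x, b + 1) ⊆ insert (y, c) (R.erase (x, b + 1)) := by
      intro A c hA hne
      constructor
      · intro h
        rcases Finset.mem_insert.1 (hA h) with h | h
        · exact hne h.symm
        · exact hC h
      · intro l hl
        rw [Finset.mem_erase] at hl
        rcases Finset.mem_insert.1 (hA hl.2) with h | h
        · exact Finset.mem_insert.2 (.inl h)
        · exact Finset.mem_insert.2 (.inr (Finset.mem_erase.2 ⟨hl.1, h⟩))
    have key' : ∀ (A : Clause V), A ⊆ insert (x, b + 1) R →
        (x, b) ∉ A ∧ A.erase (x, b + 1) ⊆ R.erase (x, b + 1) := by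
      intro A hA
      constructor
      · intro h
        rcases Finset.mem_insert.1 (hA h) with h | h
        · exact zmod_two_add_one_ne b (by simpa using h.symm)
        · exact hC h
      · intro l hl
        rw [Finset.mem_erase] at hl
        rcases Finset.mem_insert.1 (hA hl.2) with h | h
        · exact absurd h hl.1
        · exact Finset.mem_erase.2 ⟨hl.1, h⟩
    by_cases hxy : y = x
    · subst hxy
      have hb := zmod_two_cases b
      rcases hb with rfl | rfl
      · obtain ⟨h1, h2⟩ := key' A (by simpa using hAR)
        exact (hA h1).weaken y h2 hR'
      · obtain ⟨h1, h2⟩ := key' B hBR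
        exact (hB h1).weaken y h2 hR'
    · obtain ⟨h1, h2⟩ := key A 1 hAR (by simp [hxy])
      obtain ⟨h3, h4⟩ := key B 0 hBR (by simp [hxy])
      exact .res y (hA h1) (hB h3) h2 h4 hR'

/-- The clauses of width at most `w`. -/
def widthLE (V : Type*) (w : ℕ) : Set (Clause V) := {C | C.card ≤ w}

/-- The erased literal is put back into every line, which costs one unit of width. -/
theorem Der.of_restrict {F : CNF V} {x : V} {b : ZMod 2} {w : ℕ} {C : Clause V}
    (h : Der (restrict F x b) (widthLE V w) C) :
    Der F (widthLE V (w + 1)) (insert (x, b + 1) C) := by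
  induction h with
  | @ax C D hC hCD hD =>
    obtain ⟨C', hC', -, rfl⟩ := mem_restrict.1 hC
    exact .ax hC' (Finset.subset_insert_iff.2 hCD)
      ((Finset.card_insert_le _ _).trans (Nat.succ_le_succ hD))
  | @res A B R y _ _ hAR hBR hR hA hB =>
    refine .res y hA hB ?_ ?_ ((Finset.card_insert_le _ _).trans (Nat.succ_le_succ hR))
    · rw [Finset.insert_comm]; exact Finset.insert_subset_insert _ hAR
    · rw [Finset.insert_comm]; exact Finset.insert_subset_insert _ hBR

/-- Resolving each axiom with the unit clause removes the erased literal at once, so the width does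
not grow. -/
theorem Der.of_restrict_of_unit {F : CNF V} {x : V} {b : ZMod 2} {w : ℕ}
    (hF : ∀ C ∈ F, C.card ≤ w) (hu : Der F (widthLE V w) {(x, b)}) {C : Clause V}
    (h : Der (restrict F x b) (widthLE V w) C) : Der F (widthLE V w) C := by
  induction h with
  | @ax C D hC hCD hD =>
    obtain ⟨C', hC', -, rfl⟩ := mem_restrict.1 hC
    exact .resolve x b hu (.ax hC' subset_rfl (hF _ hC')) (by simp)
      (Finset.subset_insert_iff.2 hCD) hD
  | res y _ _ hAR hBR hR hA hB => exact .res y hA hB hAR hBR hR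

/-- The first branch yields a unit clause, which the second branch uses for free. This asymmetry
keeps the width additive in the number of favourable branches. -/
theorem Der.combine {F : CNF V} {x : V} {b : ZMod 2} {w : ℕ} (hF : ∀ C ∈ F, C.card ≤ w + 1)
    (h₁ : Der (restrict F x b) (widthLE V w) ∅)
    (h₂ : Der (restrict F x (b + 1)) (widthLE V (w + 1)) ∅) :
    Der F (widthLE V (w + 1)) ∅ :=
  .of_restrict_of_unit hF (by simpa using h₁.of_restrict) h₂

theorem card_le_of_mem_restrict {F : CNF V} {w : ℕ} (hF : ∀ C ∈ F, C.card ≤ w) (x : V)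
    (b : ZMod 2) : ∀ C ∈ restrict F x b, C.card ≤ w := by
  intro C hC
  obtain ⟨C', hC', -, rfl⟩ := mem_restrict.1 hC
  exact (Finset.card_erase_le).trans (hF _ hC')

theorem IsResRefutation.der {F : CNF V} {s : ℕ} {π : Fin s → Clause V}
    (h : IsResRefutation F π) : Der F (Finset.univ.image π : CNF V) ∅ := by
  have key : ∀ i : Fin s, Der F (Finset.univ.image π : CNF V) (π i) := by
    intro i
    induction i using WellFoundedLT.induction with
    | _ i ih =>
      have hi : π i ∈ ((Finset.univ.image π : CNF V) : Set (Clause V)) := by simp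
      rcases h.1 i with h | ⟨j, k, hj, hk, x, C, D, hC, hD, hR⟩
      · exact .ax h subset_rfl hi
      · refine .res x (ih j hj) (ih k hk) ?_ ?_ hi
        · rw [hC, hR]; exact Finset.insert_subset_insert _ Finset.subset_union_left
        · rw [hD, hR]; exact Finset.insert_subset_insert _ Finset.subset_union_right
  obtain ⟨i, hi⟩ := h.2
  exact hi ▸ key i

/-- The clauses of `P` of width more than `f`. -/
def fat (P : CNF V) (f : ℕ) : CNF V := P.filter fun C => f < C.card

theorem card_fat_restrict_le (P : CNF V) (f : ℕ) (x : V) (b : ZMod 2) :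
    (fat (restrict P x b) f).card ≤ ((fat P f).filter fun C => (x, b) ∉ C).card := by
  refine (Finset.card_le_card ?_).trans
    (Finset.card_image_le (f := fun C : Clause V => C.erase (x, b + 1)))
  intro D hD
  rw [fat, Finset.mem_filter, mem_restrict] at hD
  obtain ⟨⟨C, hC, hx, rfl⟩, hf⟩ := hD
  refine Finset.mem_image.2 ⟨C, ?_, rfl⟩
  simp only [fat, Finset.mem_filter]
  exact ⟨⟨hC, hf.trans_le Finset.card_erase_le⟩, hx⟩

/-- Refutations with few wide clauses can be turned into narrow refutations. -/
theorem Der.width_of_size {f N w : ℕ} {q : ℝ} (hq : 0 ≤ q) (hqf : 2 * N * (1 - q) ≤ f)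
    (m : ℕ) : ∀ (b : ℕ) (F P : CNF V) (U : Finset V), U.card = m → U.card ≤ N →
      (∀ C ∈ P, ∀ l ∈ C, l.1 ∈ U) → (∀ C ∈ F, C.card ≤ w) → Der F P ∅ →
      (fat P f).card * q ^ b < 1 → Der F (widthLE V (w + f + b)) ∅ := by
  induction m with
  | zero =>
    intro b F P U hU _ hP _ h _
    refine h.mono fun C hC => ?_
    have : C = ∅ := by
      refine Finset.eq_empty_of_forall_notMem fun l hl => ?_
      have := hP C hC l hl
      rw [Finset.card_eq_zero.1 hU] at this
      simp at this
    simp [this, widthLE]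
  | succ m ih =>
    intro b F P U hU hUN hP hF h hfat
    by_cases h0 : (fat P f).card = 0
    · refine h.mono fun C hC => ?_
      by_contra hC'
      rw [Finset.card_eq_zero] at h0
      have : C ∈ fat P f := by
        simp only [widthLE, Set.mem_ofPred_eq, not_le] at hC'
        exact Finset.mem_filter.2 ⟨hC, by omega⟩
      simp [h0] at this
    -- `b` is the remaining width budget; at `b = 0` there would be no wide clause left.
    obtain ⟨b, rfl⟩ : ∃ b', b = b' + 1 := by
      refine Nat.exists_eq_succ_of_ne_zero ?_
      rintro rfl
      simp only [pow_zero, mul_one] at hfat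
      exact h0 (by exact_mod_cast Nat.lt_one_iff.1 (by exact_mod_cast hfat))
    have hUne : U.Nonempty := Finset.card_pos.1 (by omega)
    have hsum : ∑ l ∈ U ×ˢ (Finset.univ : Finset (ZMod 2)),
        ((fat P f).filter fun C => l ∈ C).card = ∑ C ∈ fat P f, C.card := by
      simp_rw [Finset.card_filter]
      rw [Finset.sum_comm]
      refine Finset.sum_congr rfl fun C hC => ?_
      rw [← Finset.card_filter]
      congr 1
      ext l
      simp only [Finset.mem_filter, Finset.mem_product, Finset.mem_univ, and_true,
        and_iff_right_iff_imp]
      exact hP C (Finset.mem_filter.1 hC).1 l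
    -- Averaging: each wide clause contains more than `f` of at most `2 * N` literals, so some
    -- literal lies in a fraction at least `1 - q` of the wide clauses.
    obtain ⟨⟨x, c⟩, hl, hk⟩ : ∃ l ∈ U ×ˢ (Finset.univ : Finset (ZMod 2)),
        (fat P f).card * (1 - q) ≤ ((fat P f).filter fun C => l ∈ C).card := by
      refine Finset.exists_le_of_sum_le (hUne.product Finset.univ_nonempty) ?_
      have h1 : (∑ l ∈ U ×ˢ (Finset.univ : Finset (ZMod 2)),
          (((fat P f).filter fun C => l ∈ C).card : ℝ)) = ∑ C ∈ fat P f, (C.card : ℝ) := by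
        exact_mod_cast hsum
      have h2 : ((fat P f).card : ℝ) * f ≤ ∑ C ∈ fat P f, (C.card : ℝ) := by
        rw [← nsmul_eq_mul]
        refine Finset.card_nsmul_le_sum _ _ _ fun C hC => ?_
        exact_mod_cast (Finset.mem_filter.1 hC).2.le
      rw [h1, Finset.sum_const, Finset.card_product, Finset.card_univ, ZMod.card, nsmul_eq_mul]
      refine le_trans ?_ h2
      have h3 : ((U.card * 2 : ℕ) : ℝ) * (1 - q) ≤ f := by
        rcases le_total 0 (1 - q) with hq1 | hq1
        · refine le_trans (mul_le_mul_of_nonneg_right ?_ hq1) hqf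
          have : (U.card : ℝ) ≤ N := by exact_mod_cast hUN
          push_cast; linarith
        · exact (mul_nonpos_of_nonneg_of_nonpos (by positivity) hq1).trans (by positivity)
      nlinarith [Nat.cast_nonneg (α := ℝ) (fat P f).card]
    have hxU : x ∈ U := (Finset.mem_product.1 hl).1
    have hvars : ∀ d, ∀ C ∈ restrict P x d, ∀ l ∈ C, l.1 ∈ U.erase x := by
      intro d C hC l hlC
      obtain ⟨C', hC', hd, rfl⟩ := mem_restrict.1 hC
      rw [Finset.mem_erase] at hlC
      refine Finset.mem_erase.2 ⟨?_, hP C' hC' l hlC.2⟩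
      rintro rfl
      obtain ⟨y, e⟩ := l
      by_cases he : e = d
      · subst he; exact hd hlC.2
      · exact hlC.1 (by rw [(zmod_two_ne_iff e d).1 he])
    have hcard : (U.erase x).card = m := by rw [Finset.card_erase_of_mem hxU]; omega
    have hsplit := Finset.card_filter_add_card_filter_not (s := fat P f) (fun C => (x, c) ∈ C)
    have hsplit' : (((fat P f).filter fun C => (x, c) ∈ C).card : ℝ) +
        ((fat P f).filter fun C => (x, c) ∉ C).card = (fat P f).card := by exact_mod_cast hsplit
    -- Making the frequent literal true leaves a fraction `q` of the wide clauses and spends one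
    -- unit of `b`. The other branch keeps the budget but loses a variable.
    refine Der.combine (x := x) (b := c) (w := w + f + b) (fun C hC => (hF C hC).trans (by omega)) ?_ ?_
    · refine ih b _ _ (U.erase x) hcard (by omega) (hvars c) (card_le_of_mem_restrict hF x c)
        (by simpa using h.restriction x c (by simp)) ?_
      have h4 : ((fat (restrict P x c) f).card : ℝ) ≤ (fat P f).card * q := by
        have : ((fat (restrict P x c) f).card : ℝ) ≤
          ((fat P f).filter fun C => (x, c) ∉ C).card := by
            exact_mod_cast card_fat_restrict_le P f x c
        linarith
      calc _ ≤ (fat P f).card * q * q ^ b := by gcongr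
        _ = (fat P f).card * q ^ (b + 1) := by ring
        _ < 1 := hfat
    · refine ih (b + 1) _ _ (U.erase x) hcard (by omega) (hvars _)
        (card_le_of_mem_restrict hF x _)
        (by simpa using h.restriction x (c + 1) (by simp)) ?_
      refine lt_of_le_of_lt ?_ hfat
      refine mul_le_mul_of_nonneg_right (Nat.cast_le.2 ?_) (by positivity)
      exact (card_fat_restrict_le P f x _).trans (Finset.card_filter_le _ _)

/-- Two surviving clauses cannot clash at `x`, since one of them would be satisfied by the
restriction; so their clash survives the erasure. -/
theorem IsHittingRefutation.restriction {F H : CNF V} (h : IsHittingRefutation F H) (x : V)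
    (b : ZMod 2) : IsHittingRefutation (restrict F x b) (restrict H x b) := by
  refine ⟨?_, ?_, ?_⟩
  · intro C' hC' D' hD' hCD
    obtain ⟨C, hC, hCx, rfl⟩ := mem_restrict.1 hC'
    obtain ⟨D, hD, hDx, rfl⟩ := mem_restrict.1 hD'
    obtain ⟨y, e, h1, h2⟩ := h.1 C hC D hD (fun h => hCD (by rw [h]))
    refine ⟨y, e, Finset.mem_erase.2 ⟨?_, h1⟩, Finset.mem_erase.2 ⟨?_, h2⟩⟩
    · intro heq
      rw [Prod.mk.injEq] at heq
      rw [heq.1, heq.2, zmod_two_add_one_add_one] at h2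
      exact hDx h2
    · intro heq
      rw [Prod.mk.injEq, add_left_inj] at heq
      rw [heq.1, heq.2] at h1
      exact hCx h1
  · intro a
    obtain ⟨C, hC, hCa⟩ := h.2.1 (Function.update a x b)
    refine ⟨C.erase (x, b + 1), mem_restrict.2 ⟨C, hC, fun hx => ?_, rfl⟩, ?_⟩
    · exact hCa _ hx (by simp)
    · rintro ⟨y, e⟩ hl
      rw [Finset.mem_erase] at hl
      have h1 := hCa _ hl.2
      by_cases hy : y = x
      · subst hy
        have h2 : e ≠ b := fun he => h1 (by simp [he])
        exact absurd (by rw [(zmod_two_ne_iff e b).1 h2]) hl.1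
      · simpa [Function.update_of_ne hy] using h1
  · intro D hD
    obtain ⟨C, hC, hCx, rfl⟩ := mem_restrict.1 hD
    obtain ⟨C', hC', hsub⟩ := h.2.2 C hC
    exact ⟨_, mem_restrict.2 ⟨C', hC', fun h => hCx (hsub h), rfl⟩,
      Finset.erase_subset_erase _ hsub⟩

open Classical in
-- Each literal on a new variable halves the set of falsifying assignments. Only an inequality holds
-- because a clause with contrary literals is never falsified.
theorem card_falsified_mul_le [Fintype V] (C : Clause V) :
    (Finset.univ.filter fun a : V → ZMod 2 => Clause.Falsified C a).card * 2 ^ C.card ≤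
      2 ^ Fintype.card V := by
  induction C using Finset.induction_on with
  | empty => simp [Clause.Falsified, ZMod.card]
  | @insert l C hl ih =>
    rw [Finset.card_insert_of_notMem hl, pow_succ', ← mul_assoc]
    refine le_trans (Nat.mul_le_mul_right _ ?_) ih
    obtain ⟨x, b⟩ := l
    by_cases hx : (x, b + 1) ∈ C
    · rw [Finset.filter_eq_empty_iff.2]
      · simp
      · intro a _ ha
        have h1 := ha (x, b) (by simp)
        have h2 := ha (x, b + 1) (by simp [hx])
        exact h2 ((zmod_two_ne_iff _ _).1 h1)
    · have hC : ∀ e, (x, e) ∉ C := by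
        intro e he
        by_cases heb : e = b
        · exact hl (heb ▸ he)
        · exact hx ((zmod_two_ne_iff e b).1 heb ▸ he)
      set A := Finset.univ.filter fun a : V → ZMod 2 => Clause.Falsified (insert (x, b) C) a
      have hdisj : Disjoint A (A.image fun a => Function.update a x b) := by
        rw [Finset.disjoint_left]
        intro a ha ha'
        obtain ⟨a', -, rfl⟩ := Finset.mem_image.1 ha'
        exact (Finset.mem_filter.1 ha).2 (x, b) (by simp) (by simp)
      have hinj : (A.image fun a => Function.update a x b).card = A.card := by
        refine Finset.card_image_of_injOn fun a ha a' ha' heq => ?_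
        have h1 := (zmod_two_ne_iff _ _).1 ((Finset.mem_filter.1 ha).2 (x, b) (by simp))
        have h2 := (zmod_two_ne_iff _ _).1 ((Finset.mem_filter.1 ha').2 (x, b) (by simp))
        funext y
        by_cases hy : y = x
        · subst hy; exact h1.trans h2.symm
        · simpa [Function.update_of_ne hy] using congrFun heq y
      rw [mul_two]
      nth_rw 2 [← hinj]
      rw [← Finset.card_union_of_disjoint hdisj]
      refine Finset.card_le_card (Finset.union_subset ?_ ?_)
      · intro a ha
        refine Finset.mem_filter.2 ⟨Finset.mem_univ _, fun l hl => ?_⟩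
        exact (Finset.mem_filter.1 ha).2 l (Finset.mem_insert_of_mem hl)
      · intro a ha
        obtain ⟨a', ha', rfl⟩ := Finset.mem_image.1 ha
        refine Finset.mem_filter.2 ⟨Finset.mem_univ _, fun l hl => ?_⟩
        have : l.1 ≠ x := fun hlx => hC l.2 (hlx ▸ hl)
        rw [Function.update_of_ne this]
        exact (Finset.mem_filter.1 ha').2 l (Finset.mem_insert_of_mem hl)

/-- An unsatisfiable formula with fewer than `2 ^ (L + 1)` clauses has one of width at most `L`. -/
theorem CNF.Unsat.exists_card_le [Fintype V] {H : CNF V} (h : CNF.Unsat H) {L : ℕ}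
    (hL : H.card < 2 ^ (L + 1)) : ∃ C ∈ H, C.card ≤ L := by
  classical
  by_contra! hC
  have h1 : (Finset.univ : Finset (V → ZMod 2)) ⊆
      H.biUnion fun C => Finset.univ.filter fun a => Clause.Falsified C a := by
    intro a _
    obtain ⟨C, hC, ha⟩ := h a
    exact Finset.mem_biUnion.2 ⟨C, hC, by simpa using ha⟩
  have h2 := (Finset.card_le_card h1).trans Finset.card_biUnion_le
  have h3 : (∑ C ∈ H, (Finset.univ.filter fun a : V → ZMod 2 => Clause.Falsified C a).card) *
      2 ^ (L + 1) ≤ H.card * 2 ^ Fintype.card V := by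
    rw [Finset.sum_mul, ← smul_eq_mul (H.card)]
    refine Finset.sum_le_card_nsmul _ _ _ fun C hCH => ?_
    exact (Nat.mul_le_mul_left _ (Nat.pow_le_pow_right (by norm_num) (hC C hCH))).trans
      (card_falsified_mul_le C)
  have h4 : (Finset.univ : Finset (V → ZMod 2)).card = 2 ^ Fintype.card V := by
    simp [ZMod.card]
  rw [h4] at h2
  have h5 : 0 < 2 ^ Fintype.card V := by positivity
  nlinarith [Nat.mul_le_mul_right (2 ^ (L + 1)) h2]

/-- Small Hitting refutations can be turned into narrow resolution refutations. -/
theorem IsHittingRefutation.width [Fintype V] {L w : ℕ} {q : ℝ} (hq : 0 ≤ q)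
    (hqL : L * (1 - q) ≤ 1) (m : ℕ) : ∀ (b : ℕ) (F H : CNF V), H.card = m →
      IsHittingRefutation F H → (∀ C ∈ F, C.card ≤ w) → H.card < 2 ^ (L + 1) →
      ((H.card : ℝ) - 1) * q ^ b < 1 → Der F (widthLE V (w + b)) ∅ := by
  induction m using Nat.strong_induction_on with
  | _ m ih =>
    intro b F H hm hH hF hL hb
    by_cases h1 : H.card ≤ 1
    · obtain ⟨C, hC, hCL⟩ := hH.2.1 (fun _ => 0)
      have hall : ∀ a, Clause.Falsified C a := fun a => by
        obtain ⟨D, hD, hDa⟩ := hH.2.1 a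
        exact Finset.card_le_one.1 h1 D hD C hC ▸ hDa
      have hC0 : C = ∅ := Finset.eq_empty_of_forall_notMem fun l hl =>
        hall (fun _ => l.2) l hl rfl
      obtain ⟨C', hC', hsub⟩ := hH.2.2 C hC
      exact .ax hC' (hC0 ▸ hsub) (by simp [widthLE])
    push Not at h1
    have hcard1 : (1 : ℝ) ≤ (H.card : ℝ) - 1 := by
      have : (2 : ℝ) ≤ H.card := by exact_mod_cast h1
      linarith
    obtain ⟨b, rfl⟩ : ∃ b', b = b' + 1 := by
      refine Nat.exists_eq_succ_of_ne_zero ?_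
      rintro rfl
      simp only [pow_zero, mul_one] at hb
      linarith
    obtain ⟨C, hC, hCL⟩ := hH.2.1.exists_card_le hL
    -- Every other clause contradicts one of the at most `L` literals of `C`. As `C` itself is not
    -- covered, the measure is `H.card - 1`.
    have hcover : H.erase C ⊆ C.biUnion fun l => H.filter fun D => (l.1, l.2 + 1) ∈ D := by
      intro D hD
      rw [Finset.mem_erase] at hD
      obtain ⟨x, e, hx, hx'⟩ := hH.1 C hC D hD.2 hD.1.symm
      exact Finset.mem_biUnion.2 ⟨(x, e), hx, Finset.mem_filter.2 ⟨hD.2, hx'⟩⟩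
    have hle := (Finset.card_le_card hcover).trans Finset.card_biUnion_le
    rw [Finset.card_erase_of_mem hC] at hle
    have hle' : (H.card : ℝ) - 1 ≤
        ∑ l ∈ C, ((H.filter fun D => (l.1, l.2 + 1) ∈ D).card : ℝ) := by
      have : (H.card : ℝ) - 1 = ((H.card - 1 : ℕ) : ℝ) := by
        rw [Nat.cast_sub h1.le]; simp
      rw [this]; exact_mod_cast hle
    have hCne : C.Nonempty := by
      rw [Finset.nonempty_iff_ne_empty]
      rintro rfl
      simp at hle'
      linarith
    obtain ⟨⟨x, c⟩, hl, hk⟩ : ∃ l ∈ C, ((H.card : ℝ) - 1) / C.card ≤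
        ((H.filter fun D => (l.1, l.2 + 1) ∈ D).card : ℝ) := by
      refine Finset.exists_le_of_sum_le hCne ?_
      have : (C.card : ℝ) ≠ 0 := by exact_mod_cast hCne.card_pos.ne'
      rw [Finset.sum_const, nsmul_eq_mul, mul_div_cancel₀ _ this]
      exact hle'
    simp only at hk
    have hCpos : (0 : ℝ) < C.card := by exact_mod_cast hCne.card_pos
    have hkpos : 0 < (H.filter fun D => (x, c + 1) ∈ D).card := by
      have : (0 : ℝ) < (H.filter fun D => (x, c + 1) ∈ D).card :=
        lt_of_lt_of_le (by positivity) hk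
      exact_mod_cast this
    have hk' : ((H.card : ℝ) - 1) * (1 - q) ≤ (H.filter fun D => (x, c + 1) ∈ D).card := by
      refine le_trans ?_ hk
      rw [le_div_iff₀ hCpos, mul_assoc]
      refine mul_le_of_le_one_right (by linarith) ?_
      rcases le_total 0 (1 - q) with hq1 | hq1
      · have : (C.card : ℝ) ≤ L := by exact_mod_cast hCL
        nlinarith
      · nlinarith
    have hsplit := Finset.card_filter_add_card_filter_not (s := H) (fun D => (x, c + 1) ∈ D)
    have hr1 := card_restrict_le H x (c + 1)
    -- Falsifying the chosen literal of `C` satisfies many other clauses. Satisfying it removes at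
    -- least `C`, enough for the induction on the size of `H`.
    refine Der.combine (x := x) (b := c + 1) (w := w + b)
      (fun C hC => (hF C hC).trans (by omega)) ?_ ?_
    · refine ih _ ?_ b _ _ rfl (hH.restriction x (c + 1)) (card_le_of_mem_restrict hF x _)
        (by omega) ?_
      · omega
      · have h4 : ((restrict H x (c + 1)).card : ℝ) - 1 ≤ ((H.card : ℝ) - 1) * q := by
          have h5 : ((restrict H x (c + 1)).card : ℝ) +
            (H.filter fun D => (x, c + 1) ∈ D).card ≤ H.card := by
              exact_mod_cast (by omega)
          linarith
        calc _ ≤ ((H.card : ℝ) - 1) * q * q ^ b := by gcongr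
          _ = ((H.card : ℝ) - 1) * q ^ (b + 1) := by ring
          _ < 1 := hb
    · rw [zmod_two_add_one_add_one]
      have hlt : (restrict H x c).card < H.card := by
        refine (card_restrict_le H x c).trans_lt (Finset.card_lt_card ?_)
        exact Finset.filter_ssubset.2 ⟨C, hC, by simpa using hl⟩
      refine ih _ (hm ▸ hlt) (b + 1) _ _ rfl (hH.restriction x c) (card_le_of_mem_restrict hF x _)
        (by omega) ?_
      refine lt_of_le_of_lt ?_ hb
      gcongr

end Width

end PC

namespace PC

/-! ### Width lower bound for Tseitin formulas on expanders -/

section Tseitin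

variable {V : Type*} [Fintype V]

theorem mem_incident {G : SimpleGraph V} {v : V} {e : G.edgeSet} :
    e ∈ incident G v ↔ v ∈ (e : Sym2 V) := by
  simp [incident]

open Classical in
theorem card_incident_le (G : SimpleGraph V) (v : V) : (incident G v).card ≤ G.degree v := by
  rw [← SimpleGraph.card_incidenceFinset_eq_degree,
    ← Finset.card_image_of_injective (incident G v) Subtype.val_injective]
  refine Finset.card_le_card fun e' he' => ?_
  obtain ⟨e, he, rfl⟩ := Finset.mem_image.1 he'
  rw [SimpleGraph.mem_incidenceFinset]
  exact ⟨e.2, mem_incident.1 he⟩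

open Classical in
/-- The clause on the edges at `v` that is falsified exactly when `T` is the set of edges at `v`
with value `1`. -/
noncomputable def vertexClause (G : SimpleGraph V) (v : V) (T : Finset G.edgeSet) :
    Clause G.edgeSet :=
  (incident G v).image fun e => (e, if e ∈ T then 0 else 1)

theorem mem_tseitin {G : SimpleGraph V} {c : V → ZMod 2} {C : Clause G.edgeSet} :
    C ∈ tseitin G c ↔
      ∃ v, ∃ T ⊆ incident G v, (T.card : ZMod 2) ≠ c v ∧ vertexClause G v T = C := by
  simp [tseitin, vertexClause, and_assoc]

open Classical in
theorem falsified_vertexClause {G : SimpleGraph V} {v : V} {T : Finset G.edgeSet}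
    {a : G.edgeSet → ZMod 2} :
    Clause.Falsified (vertexClause G v T) a ↔ ∀ e ∈ incident G v, (a e = 1 ↔ e ∈ T) := by
  have key : ∀ (x : ZMod 2) (p : Prop) [Decidable p], x ≠ (if p then 0 else 1) ↔ (x = 1 ↔ p) := by
    intro x p _
    rcases zmod_two_cases x with rfl | rfl <;> by_cases hp : p <;> simp [hp]
  simp only [Clause.Falsified, vertexClause, Finset.mem_image, forall_exists_index, and_imp]
  constructor
  · intro h e he
    exact (key _ _).1 (h _ e he rfl)
  · rintro h _ e he rfl
    exact (key _ _).2 (h e he)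

theorem sum_eq_card_of_iff {ι : Type*} {I T : Finset ι} (hT : T ⊆ I) {a : ι → ZMod 2}
    (h : ∀ e ∈ I, (a e = 1 ↔ e ∈ T)) : ∑ e ∈ I, a e = T.card := by
  rw [← Finset.sum_subset hT, Finset.sum_congr rfl fun e he => (h e (hT he)).2 he]
  · simp
  · intro e he heT
    rcases zmod_two_cases (a e) with h0 | h1
    · exact h0
    · exact absurd ((h e he).1 h1) heT

open Classical in
theorem card_le_of_mem_tseitin {G : SimpleGraph V} {d : ℕ} {γ : ℝ} (hG : IsExpander G d γ)
    {c : V → ZMod 2} : ∀ C ∈ tseitin G c, C.card ≤ d := by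
  intro C hC
  obtain ⟨v, T, -, -, rfl⟩ := mem_tseitin.1 hC
  exact Finset.card_image_le.trans ((card_incident_le G v).trans (hG.1 v))

/-- The parity constraints at the vertices in `S` imply the clause `C`. -/
def Supports (G : SimpleGraph V) (c : V → ZMod 2) (S : Finset V) (C : Clause G.edgeSet) : Prop :=
  ∀ a : G.edgeSet → ZMod 2, (∀ v ∈ S, ∑ e ∈ incident G v, a e = c v) → ¬ Clause.Falsified C a

open Classical in
-- By minimality, for `v ∈ S` some assignment falsifies `C` and violates, within `S`, only `v`.
-- Flipping a boundary edge at `v` repairs `v` and touches no other vertex of `S`; so `C` must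
-- mention that edge.
theorem card_interedges_le_of_minimal {G : SimpleGraph V} {c : V → ZMod 2} {S : Finset V}
    {C : Clause G.edgeSet} (hS : Supports G c S C)
    (hmin : ∀ v ∈ S, ¬ Supports G c (S.erase v) C) :
    (G.interedges S Sᶜ).card ≤ C.card := by
  refine le_trans ?_ (Finset.card_image_le (s := C) (f := fun l => (l.1 : Sym2 V)))
  refine Finset.card_le_card_of_injOn (fun p => s(p.1, p.2)) ?_ ?_
  · rintro ⟨v, u⟩ hp
    obtain ⟨hv, hu, hadj⟩ := Rel.mem_interedges_iff.1 (Finset.mem_coe.1 hp)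
    simp only [Finset.mem_compl] at hv hu hadj
    let e : G.edgeSet := ⟨s(v, u), hadj⟩
    have hm := hmin v hv
    simp only [Supports, not_forall, not_not] at hm
    obtain ⟨a, ha, hCa⟩ := hm
    have hva : ∑ e ∈ incident G v, a e ≠ c v := by
      intro h
      refine hS a (fun x hx => ?_) hCa
      by_cases hxv : x = v
      · rw [hxv]; exact h
      · exact ha x (Finset.mem_erase.2 ⟨hxv, hx⟩)
    by_contra hcon
    have hnot : ∀ l ∈ C, l.1 ≠ e := by
      rintro l hl hle
      exact hcon (Finset.mem_coe.2 (Finset.mem_image.2 ⟨l, hl, by rw [hle]⟩))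
    refine hS (Function.update a e (a e + 1)) (fun x hx => ?_) fun l hl => ?_
    · by_cases hxv : x = v
      · have hev : e ∈ incident G v := mem_incident.2 (by simp [e])
        rw [hxv, Finset.sum_update_of_mem hev, ← zmod_two_add_one_add_one (c v),
          ← (zmod_two_ne_iff _ _).1 hva, ← Finset.add_sum_erase _ _ hev,
          Finset.sdiff_singleton_eq_erase]
        ring
      · have hev : e ∉ incident G x := by
          rw [mem_incident]
          intro h
          rcases Sym2.mem_iff.1 h with h | h
          · exact hxv h
          · exact hu (h ▸ hx)
        rw [Finset.sum_update_of_notMem hev]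
        exact ha x (Finset.mem_erase.2 ⟨hxv, hx⟩)
    · rw [Function.update_of_ne (hnot l hl)]
      exact hCa l hl
  · rintro ⟨v, u⟩ hp ⟨v', u'⟩ hp' heq
    obtain ⟨hv, hu, -⟩ := Rel.mem_interedges_iff.1 (Finset.mem_coe.1 hp)
    obtain ⟨hv', hu', -⟩ := Rel.mem_interedges_iff.1 (Finset.mem_coe.1 hp')
    simp only [Finset.mem_compl] at hv hu hv' hu'
    rcases Sym2.eq_iff.1 heq with ⟨h1, h2⟩ | ⟨h1, h2⟩
    · simp_all
    · simp only at h1 h2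
      exact absurd (h1 ▸ hv) hu'

theorem Supports.exists_minimal {G : SimpleGraph V} {c : V → ZMod 2} {S : Finset V}
    {C : Clause G.edgeSet} [DecidableEq V] (hS : Supports G c S C) :
    ∃ S' ⊆ S, Supports G c S' C ∧ ∀ v ∈ S', ¬ Supports G c (S'.erase v) C := by
  induction S using Finset.strongInduction with
  | H S ih =>
    by_cases h : ∃ v ∈ S, Supports G c (S.erase v) C
    · obtain ⟨v, hv, hvS⟩ := h
      obtain ⟨S', h1, h2⟩ := ih _ (Finset.erase_ssubset hv) hvS
      exact ⟨S', h1.trans (Finset.erase_subset _ _), h2⟩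
    · push Not at h
      exact ⟨S, subset_rfl, hS, h⟩

/-- Tseitin formulas on expanders require resolution refutations of linear width. -/
theorem IsExpander.not_der_of_width_le {G : SimpleGraph V} [DecidableEq G.edgeSet] {d : ℕ} {γ : ℝ}
    (hγ : 0 < γ) (hG : IsExpander G d γ) (c : V → ZMod 2) (hV : 4 ≤ Fintype.card V) {w : ℕ}
    (hw : 4 * (w : ℝ) ≤ γ * Fintype.card V) :
    ¬ Der (tseitin G c) (widthLE _ w) ∅ := by
  classical
  have shrink : ∀ (S : Finset V) (C : Clause G.edgeSet), Supports G c S C →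
      2 * S.card ≤ Fintype.card V → ∃ S', Supports G c S' C ∧ γ * S'.card ≤ C.card := by
    intro S C hS hcard
    obtain ⟨S', h1, h2, h3⟩ := hS.exists_minimal
    refine ⟨S', h2, ?_⟩
    have h4 := card_interedges_le_of_minimal h2 h3
    have h5 := hG.2 S' (by have := Finset.card_le_card h1; omega)
    refine h5.trans ?_
    convert (Nat.cast_le (α := ℝ)).2 h4
  have key : ∀ C : Clause G.edgeSet, Der (tseitin G c) (widthLE _ w) C →
      ∃ S, Supports G c S C ∧ 4 * S.card ≤ Fintype.card V := by
    intro C hC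
    induction hC with
    | @ax C D hC hCD hD =>
      obtain ⟨v, T, hT, hTv, rfl⟩ := mem_tseitin.1 hC
      refine ⟨{v}, fun a ha hf => hTv ?_, by simpa using hV⟩
      rw [← ha v (by simp)]
      exact (sum_eq_card_of_iff hT
        (falsified_vertexClause.1 fun l hl => hf l (hCD hl))).symm
    | @res A B R x _ _ hAR hBR hR hA hB =>
      obtain ⟨S₁, h1, h1'⟩ := hA
      obtain ⟨S₂, h2, h2'⟩ := hB
      have hsup : Supports G c (S₁ ∪ S₂) R := by
        intro a ha hf
        rcases zmod_two_cases (a x) with hx | hx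
        · refine h1 a (fun v hv => ha v (Finset.mem_union_left _ hv)) fun l hl => ?_
          rcases Finset.mem_insert.1 (hAR hl) with rfl | hl
          · simp [hx]
          · exact hf l hl
        · refine h2 a (fun v hv => ha v (Finset.mem_union_right _ hv)) fun l hl => ?_
          rcases Finset.mem_insert.1 (hBR hl) with rfl | hl
          · simp [hx]
          · exact hf l hl
      have := Finset.card_union_le S₁ S₂
      obtain ⟨S, hS, hS'⟩ := shrink _ R hsup (by omega)
      refine ⟨S, hS, ?_⟩
      have hRw : (R.card : ℝ) ≤ w := by exact_mod_cast hR
      have : γ * (4 * S.card : ℝ) ≤ γ * Fintype.card V := by linarith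
      have := le_of_mul_le_mul_left this hγ
      exact_mod_cast this
  intro h
  obtain ⟨S, hS, hcard⟩ := key _ h
  -- The empty clause has width 0, so its support shrinks to the empty set, which supports nothing
  -- falsifiable.
  obtain ⟨S', hS', hcard'⟩ := shrink S ∅ hS (by omega)
  have h0 : S' = ∅ := by
    rw [← Finset.card_eq_zero]
    by_contra hne
    have : (0 : ℝ) < S'.card := by exact_mod_cast Nat.pos_of_ne_zero hne
    simp only [Finset.card_empty, Nat.cast_zero] at hcard'
    nlinarith
  subst h0
  exact hS' (fun _ => 0) (by simp) (by simp [Clause.Falsified])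

end Tseitin

end PC

namespace PC

/-! ### Existence of bounded-degree expanders -/

section Expander

variable {n : ℕ}

/-- The permutations that map `S` into `T`. -/
def permsInto (S T : Finset (Fin n)) : Finset (Equiv.Perm (Fin n)) :=
  Finset.univ.filter fun σ => ∀ x ∈ S, σ x ∈ T

theorem mem_permsInto {S T : Finset (Fin n)} {σ : Equiv.Perm (Fin n)} :
    σ ∈ permsInto S T ↔ ∀ x ∈ S, σ x ∈ T := by
  simp [permsInto]

/-- Double counting of pairs of `σ` and `z ∉ S` with `σ z ∈ T`: composing with the swap of `x` and
`z` shows that all `z` are equally frequent. -/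
theorem card_permsInto_insert (S T : Finset (Fin n)) {x : Fin n} (hx : x ∉ S) :
    (permsInto (insert x S) T).card * (n - S.card) =
      (permsInto S T).card * (T.card - S.card) := by
  have h1 : ∀ z ∈ Sᶜ, ((permsInto S T).filter fun σ => σ z ∈ T).card =
      (permsInto (insert x S) T).card := by
    intro z hz
    rw [Finset.mem_compl] at hz
    have hfix : ∀ y ∈ S, Equiv.swap x z y = y := fun y hy =>
      Equiv.swap_apply_of_ne_of_ne (fun h => hx (h ▸ hy)) (fun h => hz (h ▸ hy))
    refine Finset.card_nbij' (fun σ => σ * Equiv.swap x z) (fun σ => σ * Equiv.swap x z)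
      ?_ ?_ ?_ ?_
    · intro σ hσ
      simp only [Finset.coe_filter, mem_permsInto, Set.mem_ofPred_eq] at hσ
      rw [Finset.mem_coe, mem_permsInto]
      intro y hy
      rcases Finset.mem_insert.1 hy with rfl | hy
      · simpa using hσ.2
      · simpa [hfix y hy] using hσ.1 y hy
    · intro σ hσ
      rw [Finset.mem_coe, mem_permsInto] at hσ
      simp only [Finset.coe_filter, mem_permsInto, Set.mem_ofPred_eq]
      refine ⟨fun y hy => ?_, by simpa using hσ x (by simp)⟩
      simpa [hfix y hy] using hσ y (by simp [hy])
    · intro σ _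
      simp [mul_assoc]
    · intro σ _
      simp [mul_assoc]
  have h2 : ∀ σ ∈ permsInto S T, (Sᶜ.filter fun z => σ z ∈ T).card = T.card - S.card := by
    intro σ hσ
    rw [mem_permsInto] at hσ
    have hsub : S.image σ ⊆ T := by
      intro y hy
      obtain ⟨x, hx, rfl⟩ := Finset.mem_image.1 hy
      exact hσ x hx
    rw [← Finset.card_image_of_injective S σ.injective, ← Finset.card_sdiff_of_subset hsub,
      ← Finset.card_image_of_injective _ σ.injective]
    congr 1
    ext y
    simp only [Finset.mem_image, Finset.mem_filter, Finset.mem_compl, Finset.mem_sdiff, not_exists,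
      not_and]
    constructor
    · rintro ⟨z, ⟨hz, hzT⟩, rfl⟩
      exact ⟨hzT, fun w hw h => hz (σ.injective h ▸ hw)⟩
    · rintro ⟨hy, h⟩
      exact ⟨σ.symm y, ⟨fun hs => h _ hs (by simp), by simpa using hy⟩, by simp⟩
  have h3 : ∑ z ∈ Sᶜ, ((permsInto S T).filter fun σ => σ z ∈ T).card =
      ∑ σ ∈ permsInto S T, (Sᶜ.filter fun z => σ z ∈ T).card := by
    simp_rw [Finset.card_filter]
    exact Finset.sum_comm
  rw [Finset.sum_congr rfl h1, Finset.sum_congr rfl h2, Finset.sum_const, Finset.sum_const,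
    Finset.card_compl, Fintype.card_fin, smul_eq_mul, smul_eq_mul] at h3
  rw [← h3, mul_comm]

/-- Revealing the images of `S` one by one, each conditional probability (|T| - i)/(n - i) is at
most |T|/n. -/
theorem card_permsInto_mul_le (S T : Finset (Fin n)) :
    (permsInto S T).card * n ^ S.card ≤ T.card ^ S.card * n.factorial := by
  induction S using Finset.induction_on with
  | empty =>
    have : (permsInto ∅ T).card ≤ Fintype.card (Equiv.Perm (Fin n)) := Finset.card_le_univ _
    rw [Fintype.card_perm, Fintype.card_fin] at this
    simpa using this
  | @insert x S hx ih =>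
    have h1 := card_permsInto_insert S T hx
    have hS : S.card < n := by
      have := Finset.card_le_univ (insert x S)
      rw [Finset.card_insert_of_notMem hx, Fintype.card_fin] at this
      omega
    have hT : T.card ≤ n := by simpa using Finset.card_le_univ T
    rw [Finset.card_insert_of_notMem hx]
    have hpos : 0 < n - S.card := by omega
    have h2 : (T.card - S.card) * n ≤ T.card * (n - S.card) := by
      rw [Nat.sub_mul, Nat.mul_sub]
      exact Nat.sub_le_sub_left (by rw [mul_comm]; exact Nat.mul_le_mul_left _ hT) _
    refine Nat.le_of_mul_le_mul_right ?_ hpos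
    calc (permsInto (insert x S) T).card * n ^ (S.card + 1) * (n - S.card)
        = ((permsInto (insert x S) T).card * (n - S.card)) * n ^ S.card * n := by ring
      _ = ((permsInto S T).card * n ^ S.card) * ((T.card - S.card) * n) := by rw [h1]; ring
      _ ≤ (T.card ^ S.card * n.factorial) * (T.card * (n - S.card)) := Nat.mul_le_mul ih h2
      _ = T.card ^ (S.card + 1) * n.factorial * (n - S.card) := by ring

/-- Weight each set by x^|R| with x = s/n: the total weight is (1 + x)^n ≤ e^s. -/
theorem card_filter_card_le_mul_le (s : ℕ) (hs : s ≤ n) :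
    (((Finset.univ : Finset (Finset (Fin n))).filter fun R => R.card ≤ s).card : ℝ) *
      (s : ℝ) ^ s ≤ (Real.exp 1 * n) ^ s := by
  rcases Nat.eq_zero_or_pos n with rfl | hn
  · obtain rfl : s = 0 := by omega
    simpa using Finset.card_filter_le (Finset.univ : Finset (Finset (Fin 0))) (fun R => R.card ≤ 0)
  have hn' : (0 : ℝ) < n := by exact_mod_cast hn
  set x : ℝ := s / n
  have hx0 : 0 ≤ x := by positivity
  have hx1 : x ≤ 1 := by
    rw [div_le_one hn']; exact_mod_cast hs
  have h1 : (((Finset.univ : Finset (Finset (Fin n))).filter fun R => R.card ≤ s).card : ℝ) *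
      x ^ s ≤ (x + 1) ^ n := by
    have h2 := Fintype.sum_pow_mul_eq_add_pow (Fin n) x 1
    rw [Fintype.card_fin] at h2
    rw [← h2, ← nsmul_eq_mul]
    refine le_trans (Finset.card_nsmul_le_sum _ (fun R => x ^ R.card * 1 ^ (n - R.card)) _ ?_)
      (Finset.sum_le_sum_of_subset_of_nonneg (Finset.filter_subset _ _)
        fun _ _ _ => by positivity)
    intro R hR
    simpa using pow_le_pow_of_le_one hx0 hx1 (Finset.mem_filter.1 hR).2
  have h3 : (x + 1) ^ n ≤ Real.exp 1 ^ s := by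
    rw [← Real.exp_nat_mul, mul_one]
    calc (x + 1) ^ n ≤ Real.exp x ^ n := by gcongr; exact Real.add_one_le_exp x
      _ = Real.exp s := by rw [← Real.exp_nat_mul, mul_div_cancel₀ _ hn'.ne']
  calc _ = (((Finset.univ : Finset (Finset (Fin n))).filter fun R => R.card ≤ s).card : ℝ) *
        x ^ s * n ^ s := by
          rw [mul_assoc, ← mul_pow, div_mul_cancel₀ _ hn'.ne']
    _ ≤ Real.exp 1 ^ s * n ^ s := by gcongr; exact h1.trans h3
    _ = _ := by rw [mul_pow]

/-- The numerical core of the union bound, with y = s/n: the choices of `S` and of `R` cost (e/y)^s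
each, and each of the 14 permutations contributes (4y/3)^s, because |S ∪ R| ≤ 4s/3. -/
theorem exp_sq_mul_pow_le {y : ℝ} (hy0 : 0 < y) (hy : y ≤ 1 / 2) :
    Real.exp 1 ^ 2 * (4 / 3 * y) ^ 14 ≤ y ^ 2 / 4 := by
  have he : Real.exp 1 ^ 2 ≤ 9 := by
    have := Real.exp_one_lt_three
    nlinarith [Real.exp_pos 1]
  have h1 : (4 / 3 * y) ^ 12 ≤ (2 / 3) ^ 12 := by
    gcongr; linarith
  calc Real.exp 1 ^ 2 * (4 / 3 * y) ^ 14
      = Real.exp 1 ^ 2 * (4 / 3 * y) ^ 12 * (16 / 9 * y ^ 2) := by ring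
    _ ≤ 9 * (2 / 3) ^ 12 * (16 / 9 * y ^ 2) := by gcongr
    _ ≤ y ^ 2 / 4 := by nlinarith [sq_nonneg y]

/-- Tuples of permutations all of which map `S` into `T`. -/
def tuplesInto (S T : Finset (Fin n)) : Finset (Fin 14 → Equiv.Perm (Fin n)) :=
  Fintype.piFinset fun _ => permsInto S T

/-- The tuples of permutations that do not expand some set of size `s`. -/
def badTuples (n s : ℕ) : Finset (Fin 14 → Equiv.Perm (Fin n)) :=
  ((Finset.univ.filter fun S : Finset (Fin n) => S.card = s) ×ˢ
    (Finset.univ.filter fun R : Finset (Fin n) => 3 * R.card < s)).biUnion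
      fun p => tuplesInto p.1 (p.1 ∪ p.2)

theorem card_badTuples_le {s : ℕ} (hs : 0 < s) (hsn : 2 * s ≤ n) :
    ((badTuples n s).card : ℝ) ≤ (n.factorial : ℝ) ^ 14 * (1 / 4) ^ s := by
  have hs' : (0 : ℝ) < s := by exact_mod_cast hs
  have hn' : (0 : ℝ) < n := by exact_mod_cast (by omega : 0 < n)
  set A : ℝ := ((((Finset.univ : Finset (Finset (Fin n))).filter fun R => R.card ≤ s).card : ℕ) : ℝ)
  set y : ℝ := s / n
  have hy0 : 0 < y := by positivity
  have hy : y ≤ 1 / 2 := by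
    rw [div_le_div_iff₀ hn' (by norm_num)]
    have : (2 * s : ℝ) ≤ n := by exact_mod_cast hsn
    linarith
  have hA : A * y ^ s ≤ Real.exp 1 ^ s := by
    have := card_filter_card_le_mul_le s (by omega : s ≤ n)
    rw [div_pow, mul_div_assoc', div_le_iff₀ (by positivity), ← mul_pow]
    exact this
  have hone : ∀ p ∈ ((Finset.univ.filter fun S : Finset (Fin n) => S.card = s) ×ˢ
      (Finset.univ.filter fun R : Finset (Fin n) => 3 * R.card < s)),
      ((tuplesInto p.1 (p.1 ∪ p.2)).card : ℝ) ≤ ((4 / 3 * y) ^ s * n.factorial) ^ 14 := by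
    intro p hp
    simp only [Finset.mem_product, Finset.mem_filter, Finset.mem_univ, true_and] at hp
    rw [tuplesInto, Fintype.card_piFinset_const, Nat.cast_pow]
    refine pow_le_pow_left₀ (by positivity) ?_ _
    have h1 := card_permsInto_mul_le p.1 (p.1 ∪ p.2)
    rw [hp.1] at h1
    have h2 : ((p.1 ∪ p.2).card : ℝ) ≤ 4 / 3 * s := by
      have h3 : 3 * (p.1 ∪ p.2).card ≤ 4 * s := by
        have := Finset.card_union_le p.1 p.2
        omega
      have h4 : (3 * (p.1 ∪ p.2).card : ℝ) ≤ 4 * s := by exact_mod_cast h3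
      linarith
    have h5 : ((permsInto p.1 (p.1 ∪ p.2)).card : ℝ) * n ^ s ≤
        ((p.1 ∪ p.2).card : ℝ) ^ s * n.factorial := by exact_mod_cast h1
    have h6 : (4 / 3 * y) ^ s * n.factorial = (4 / 3 * s) ^ s * n.factorial / n ^ s := by
      rw [mul_div_assoc', div_pow]; ring
    rw [h6, le_div_iff₀ (by positivity)]
    refine h5.trans ?_
    gcongr
  have hcard : ((((Finset.univ.filter fun S : Finset (Fin n) => S.card = s) ×ˢ
      (Finset.univ.filter fun R : Finset (Fin n) => 3 * R.card < s))).card : ℝ) ≤ A * A := by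
    rw [Finset.card_product, Nat.cast_mul]
    refine mul_le_mul ?_ ?_ (by positivity) (by positivity)
    · refine Nat.cast_le.2 (Finset.card_le_card fun S hS => ?_)
      simp only [Finset.mem_filter, Finset.mem_univ, true_and] at hS ⊢
      omega
    · refine Nat.cast_le.2 (Finset.card_le_card fun S hS => ?_)
      simp only [Finset.mem_filter, Finset.mem_univ, true_and] at hS ⊢
      omega
  have h7 : ((badTuples n s).card : ℝ) ≤ A * A * ((4 / 3 * y) ^ s * n.factorial) ^ 14 := by
    calc ((badTuples n s).card : ℝ)
        ≤ ∑ p ∈ ((Finset.univ.filter fun S : Finset (Fin n) => S.card = s) ×ˢ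
            (Finset.univ.filter fun R : Finset (Fin n) => 3 * R.card < s)),
            ((tuplesInto p.1 (p.1 ∪ p.2)).card : ℝ) := by
          exact_mod_cast Finset.card_biUnion_le
      _ ≤ _ := Finset.sum_le_card_nsmul _ _ _ hone
      _ ≤ _ := by rw [nsmul_eq_mul]; gcongr
  refine h7.trans (le_of_mul_le_mul_right ?_ (by positivity : 0 < (y ^ 2) ^ s))
  have hring : ∀ z : ℝ, A * A * (z ^ s * n.factorial) ^ 14 * (y ^ 2) ^ s =
      (A * y ^ s) ^ 2 * (z ^ 14) ^ s * (n.factorial : ℝ) ^ 14 := fun z => by ring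
  calc A * A * ((4 / 3 * y) ^ s * n.factorial) ^ 14 * (y ^ 2) ^ s
      = (A * y ^ s) ^ 2 * ((4 / 3 * y) ^ 14) ^ s * (n.factorial : ℝ) ^ 14 := hring _
    _ ≤ (Real.exp 1 ^ s) ^ 2 * ((4 / 3 * y) ^ 14) ^ s * (n.factorial : ℝ) ^ 14 := by gcongr
    _ = (Real.exp 1 ^ 2 * (4 / 3 * y) ^ 14) ^ s * (n.factorial : ℝ) ^ 14 := by
      rw [mul_pow (Real.exp 1 ^ 2), ← pow_mul (Real.exp 1), ← pow_mul (Real.exp 1), mul_comm s 2]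
    _ ≤ (y ^ 2 / 4) ^ s * (n.factorial : ℝ) ^ 14 := by
      gcongr; exact exp_sq_mul_pow_le hy0 hy
    _ = _ := by rw [div_pow, one_div, inv_pow]; ring

theorem exists_tuple_expanding (n : ℕ) : ∃ π : Fin 14 → Equiv.Perm (Fin n),
    ∀ S R : Finset (Fin n), S.Nonempty → 2 * S.card ≤ n → 3 * R.card < S.card →
      ∃ j, ∃ x ∈ S, π j x ∉ S ∪ R := by
  set B := ((Finset.range (n + 1)).filter fun s => 0 < s ∧ 2 * s ≤ n).biUnion (badTuples n)
  have hB : (B.card : ℝ) < (n.factorial : ℝ) ^ 14 := by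
    -- The failure probabilities over all sizes s ≥ 1 sum to less than 1.
    have hgeo : ∑ s ∈ Finset.range (n + 1), (1 / 4 : ℝ) ^ (s + 1) < 1 := by
      have h := geom_sum_eq (by norm_num : (1 / 4 : ℝ) ≠ 1) (n + 1)
      simp_rw [pow_succ]
      rw [← Finset.sum_mul, h, div_mul_eq_mul_div, div_lt_iff_of_neg (by norm_num)]
      have : (0 : ℝ) < (1 / 4) ^ (n + 1) := by positivity
      linarith
    calc (B.card : ℝ)
        ≤ ∑ s ∈ (Finset.range (n + 1)).filter (fun s => 0 < s ∧ 2 * s ≤ n),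
            ((badTuples n s).card : ℝ) := by exact_mod_cast Finset.card_biUnion_le
      _ ≤ ∑ s ∈ (Finset.range (n + 1)).filter (fun s => 0 < s ∧ 2 * s ≤ n),
            (n.factorial : ℝ) ^ 14 * (1 / 4) ^ s := by
          refine Finset.sum_le_sum fun s hs => ?_
          rw [Finset.mem_filter] at hs
          exact card_badTuples_le hs.2.1 hs.2.2
      _ ≤ ∑ s ∈ (Finset.range (n + 1)).image (· + 1), (n.factorial : ℝ) ^ 14 * (1 / 4) ^ s := by
          refine Finset.sum_le_sum_of_subset_of_nonneg ?_ fun _ _ _ => by positivity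
          intro s hs
          simp only [Finset.mem_filter, Finset.mem_range] at hs
          exact Finset.mem_image.2 ⟨s - 1, by simp; omega, by omega⟩
      _ = (n.factorial : ℝ) ^ 14 * ∑ s ∈ Finset.range (n + 1), (1 / 4 : ℝ) ^ (s + 1) := by
          rw [Finset.sum_image (by simp), Finset.mul_sum]
      _ < (n.factorial : ℝ) ^ 14 * 1 := by
          have : 0 < (n.factorial : ℝ) ^ 14 := by positivity
          gcongr
      _ = _ := mul_one _
  have hcard : Fintype.card (Fin 14 → Equiv.Perm (Fin n)) = n.factorial ^ 14 := by
    simp [Fintype.card_perm]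
  obtain ⟨π, hπ⟩ : ∃ π, π ∉ B := by
    by_contra! h
    have h1 : B = Finset.univ := Finset.eq_univ_of_forall h
    rw [h1, Finset.card_univ, hcard] at hB
    push_cast at hB
    exact lt_irrefl _ hB
  refine ⟨π, fun S R hS hSn hR => ?_⟩
  by_contra! hcon
  refine hπ (Finset.mem_biUnion.2 ⟨S.card, ?_, ?_⟩)
  · simp only [Finset.mem_filter, Finset.mem_range]
    have := hS.card_pos
    omega
  · refine Finset.mem_biUnion.2 ⟨(S, R), by simpa using hR, ?_⟩
    rw [tuplesInto, Fintype.mem_piFinset]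
    intro j
    rw [mem_permsInto]
    exact fun x hx => hcon j x hx

/-- The graph whose edges join `u` and `π j u`. -/
def permGraph {k : ℕ} (π : Fin k → Equiv.Perm (Fin n)) : SimpleGraph (Fin n) :=
  SimpleGraph.fromRel fun u v => ∃ j, π j u = v

theorem exists_isExpander (n : ℕ) : ∃ G : SimpleGraph (Fin n), IsExpander G 28 (1 / 3) := by
  classical
  obtain ⟨π, hπ⟩ := exists_tuple_expanding n
  refine ⟨permGraph π, fun v => ?_, fun S hS => ?_⟩
  · rw [← SimpleGraph.card_neighborFinset_eq_degree]
    calc _ ≤ ((Finset.univ.image fun j => π j v) ∪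
          Finset.univ.image fun j => (π j).symm v).card := by
          refine Finset.card_le_card fun u hu => ?_
          rw [SimpleGraph.mem_neighborFinset, permGraph, SimpleGraph.fromRel_adj] at hu
          rcases hu.2 with ⟨j, hj⟩ | ⟨j, hj⟩
          · exact Finset.mem_union_left _ (Finset.mem_image.2 ⟨j, by simp, hj⟩)
          · exact Finset.mem_union_right _ (Finset.mem_image.2 ⟨j, by simp, by simp [← hj]⟩)
      _ ≤ 14 + 14 := (Finset.card_union_le _ _).trans
          (add_le_add (Finset.card_image_le.trans (by simp)) (Finset.card_image_le.trans (by simp)))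
  · rcases S.eq_empty_or_nonempty with rfl | hne
    · simp
    rw [Fintype.card_fin] at hS
    by_contra! hlt
    -- `R` is the set of outer endpoints of boundary edges. An image of a point of `S` outside `S ∪
    -- R` would be another such endpoint. Counting endpoints makes loops and parallel edges
    -- harmless.
    obtain ⟨j, x, hx, hjx⟩ := hπ S (((permGraph π).interedges S Sᶜ).image Prod.snd) hne hS (by
      have h1 : (((permGraph π).interedges S Sᶜ).image Prod.snd).card ≤
        ((permGraph π).interedges S Sᶜ).card := Finset.card_image_le
      have h2 : (3 * ((permGraph π).interedges S Sᶜ).card : ℝ) < S.card := by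
        have : (((permGraph π).interedges S Sᶜ).card : ℝ) < 1 / 3 * S.card :=
          lt_of_le_of_lt (le_of_eq (by congr!)) hlt
        linarith
      have h3 : 3 * ((permGraph π).interedges S Sᶜ).card < S.card := by exact_mod_cast h2
      omega)
    rw [Finset.mem_union, not_or] at hjx
    refine hjx.2 (Finset.mem_image.2 ⟨(x, π j x), ?_, rfl⟩)
    refine Rel.mem_interedges_iff.2 ⟨hx, by simpa using hjx.1, ?_⟩
    rw [permGraph, SimpleGraph.fromRel_adj]
    exact ⟨fun h : x = π j x => hjx.1 (h ▸ hx), .inl ⟨j, rfl⟩⟩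

end Expander

end PC

namespace PC

/-! ### Short refutations with linear equations -/

section Upper

theorem XorClause.Falsified.mono {V : Type*} {C D : XorClause V} {a : V → ZMod 2}
    (h : XorClause.Falsified D a) (hCD : C ⊆ D) : XorClause.Falsified C a :=
  fun q hq => h q (hCD hq)

theorem XorClause.length_le {V : Type*} {C : XorClause V} {m d : ℕ} (hC : C.card ≤ m)
    (hd : ∀ q ∈ C, q.1.card ≤ d) : XorClause.length C ≤ 1 + m * (d + 1) := by
  refine Nat.add_le_add_left ?_ 1
  refine (Finset.sum_le_card_nsmul _ _ (d + 1) fun q hq => Nat.succ_le_succ (hd q hq)).trans ?_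
  exact Nat.mul_le_mul_right _ hC

variable {n : ℕ} {G : SimpleGraph (Fin n)} {c : Fin n → ZMod 2} {d : ℕ}

theorem sum_sum_incident (a : G.edgeSet → ZMod 2) :
    ∑ v, ∑ e ∈ incident G v, a e = 0 := by
  classical
  have h : ∀ v, ∑ e ∈ incident G v, a e = ∑ e : G.edgeSet, if v ∈ (e : Sym2 (Fin n)) then a e else 0 := by
    intro v
    rw [← Finset.sum_filter]
    refine Finset.sum_congr ?_ fun _ _ => rfl
    ext e
    simp [mem_incident]
  simp_rw [h]
  rw [Finset.sum_comm]
  refine Finset.sum_eq_zero fun e _ => ?_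
  obtain ⟨e, he⟩ := e
  induction e using Sym2.inductionOn with
  | _ u w =>
    have huw : u ≠ w := G.ne_of_adj he
    rw [← Finset.sum_filter]
    have : (Finset.univ.filter fun v => v ∈ s(u, w)) = {u, w} := by
      ext v; simp
    simp only [this]
    rw [Finset.sum_pair huw]
    exact CharTwo.add_self_eq_zero _

theorem exists_violated (hc : ∑ v, c v = 1) (a : G.edgeSet → ZMod 2) :
    ∃ v, ∑ e ∈ incident G v, a e ≠ c v := by
  by_contra! h
  have := sum_sum_incident a
  simp_rw [h] at this
  rw [hc] at this
  exact one_ne_zero this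

/-- Derivations start only from axioms, so even a tautological `⊕`-clause is obtained by weakening
some clause of the formula. -/
theorem exists_mem_tseitin (hc : ∑ v, c v = 1) : ∃ C, C ∈ tseitin G c := by
  obtain ⟨v, hv⟩ : ∃ v, c v ≠ 0 := by
    by_contra! h
    simp [h] at hc
  exact ⟨_, mem_tseitin.2 ⟨v, ∅, by simp, by simpa using hv.symm, rfl⟩⟩

variable [DecidableEq G.edgeSet]

/-- The `⊕`-clause falsified exactly when the parity constraints at all vertices before `i` hold. -/
noncomputable def prefixClause (G : SimpleGraph (Fin n)) [DecidableEq G.edgeSet]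
    (c : Fin n → ZMod 2) (i : ℕ) : XorClause G.edgeSet :=
  (Finset.univ.filter fun j : Fin n => j.val < i).image fun j => (incident G j, c j + 1)

/-- The `⊕`-clause falsified exactly when `T` is the set of edges in `A` with value `1`. -/
def litClause {E : Type*} [DecidableEq E] (A T : Finset E) : XorClause E :=
  A.image fun e => ({e}, if e ∈ T then 0 else 1)

theorem falsified_prefixClause {i : ℕ} {a : G.edgeSet → ZMod 2} :
    XorClause.Falsified (prefixClause G c i) a ↔
      ∀ j : Fin n, j.val < i → ∑ e ∈ incident G j, a e = c j := by
  simp only [XorClause.Falsified, prefixClause, Finset.mem_image, Finset.mem_filter,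
    Finset.mem_univ, true_and, forall_exists_index, and_imp]
  constructor
  · intro h j hj
    have := (zmod_two_ne_iff _ _).1 (h _ j hj rfl)
    rwa [zmod_two_add_one_add_one] at this
  · rintro h _ j hj rfl
    rw [zmod_two_ne_iff, zmod_two_add_one_add_one]
    exact h j hj

theorem falsified_litClause {E : Type*} [DecidableEq E] {A T : Finset E} {a : E → ZMod 2} :
    XorClause.Falsified (litClause A T) a ↔ ∀ e ∈ A, (a e = 1 ↔ e ∈ T) := by
  have key : ∀ (x : ZMod 2) (p : Prop) [Decidable p], x ≠ (if p then 0 else 1) ↔ (x = 1 ↔ p) := by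
    intro x p _
    rcases zmod_two_cases x with rfl | rfl <;> by_cases hp : p <;> simp [hp]
  simp only [XorClause.Falsified, litClause, Finset.mem_image, forall_exists_index, and_imp]
  constructor
  · intro h e he
    have := h _ e he rfl
    rw [Finset.sum_singleton] at this
    exact (key _ _).1 this
  · rintro h _ e he rfl
    rw [Finset.sum_singleton]
    exact (key _ _).2 (h e he)

theorem toXor_vertexClause (v : Fin n) (T : Finset G.edgeSet) :
    (vertexClause G v T).toXor = litClause (incident G v) T := by
  ext q
  simp only [Clause.toXor, vertexClause, litClause, Finset.mem_image, exists_exists_and_eq_and]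
  exact exists_congr fun e => and_congr_right fun _ => by congr!

theorem card_litClause_le {E : Type*} [DecidableEq E] (A T : Finset E) :
    (litClause A T).card ≤ A.card := Finset.card_image_le

theorem card_le_of_mem_litClause {E : Type*} [DecidableEq E] {A T : Finset E} :
    ∀ q ∈ litClause A T, q.1.card ≤ 1 := by
  intro q hq
  obtain ⟨e, -, rfl⟩ := Finset.mem_image.1 hq
  simp

theorem card_prefixClause_le (i : ℕ) : (prefixClause G c i).card ≤ n :=
  Finset.card_image_le.trans ((Finset.card_filter_le _ _).trans (by simp))

theorem card_le_of_mem_prefixClause (hd : ∀ v, (incident G v).card ≤ d) (i : ℕ) :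
    ∀ q ∈ prefixClause G c i, q.1.card ≤ d := by
  intro q hq
  obtain ⟨j, -, rfl⟩ := Finset.mem_image.1 hq
  exact hd j

theorem litClause_insert_right {E : Type*} [DecidableEq E] {A T : Finset E} {e : E} (he : e ∉ A) :
    litClause A (insert e T) = litClause A T := by
  refine Finset.image_congr fun x hx => ?_
  have : x ≠ e := fun h => he (h ▸ hx)
  simp [Finset.mem_insert, this]

theorem litClause_insert_left {E : Type*} [DecidableEq E] (A T : Finset E) (e : E) :
    litClause (insert e A) T = insert ({e}, if e ∈ T then 0 else 1) (litClause A T) := by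
  simp [litClause, Finset.image_insert]

theorem prefixClause_succ (i : Fin n) :
    prefixClause G c (i + 1) = insert (incident G i, c i + 1) (prefixClause G c i) := by
  rw [prefixClause, prefixClause, ← Finset.image_insert (fun j => (incident G j, c j + 1))]
  congr 1
  ext j
  simp only [Finset.mem_filter, Finset.mem_univ, true_and, Finset.mem_insert, Fin.ext_iff]
  omega

/-- The parity constraint at `v` has a tree-like derivation whose size depends only on the
degree. -/
theorem treeResXor_constraint (hd1 : 1 ≤ d) (hd : ∀ v, (incident G v).card ≤ d)
    {C₀ : Clause G.edgeSet} (hC₀ : C₀ ∈ tseitin G c) (v : Fin n) (k : ℕ) :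
    ∀ A T : Finset G.edgeSet, A ⊆ incident G v → T ⊆ A → (incident G v \ A).card = k →
      -- A leaf costs at most two lines, an axiom and its weakening. The extra line length on the
      -- left makes the recursion `s + t + ℓ` close by doubling.
      ∃ s, s + (1 + (d + 1) * (d + 1)) ≤ 3 * 2 ^ k * (1 + (d + 1) * (d + 1)) ∧
        TreeResXor (tseitin G c) (insert (incident G v, c v) (litClause A T)) s := by
  set ℓ := 1 + (d + 1) * (d + 1)
  have hlen : ∀ A T : Finset G.edgeSet, A ⊆ incident G v →
      XorClause.length (insert (incident G v, c v) (litClause A T)) ≤ ℓ := by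
    intro A T hA
    refine XorClause.length_le ((Finset.card_insert_le _ _).trans (Nat.succ_le_succ
      ((card_litClause_le A T).trans ((Finset.card_le_card hA).trans (hd v))))) fun q hq => ?_
    rcases Finset.mem_insert.1 hq with rfl | hq
    · exact hd v
    · exact (card_le_of_mem_litClause q hq).trans hd1
  have hax : ∀ C ∈ tseitin G c, XorClause.length C.toXor ≤ ℓ := by
    intro C hC
    obtain ⟨u, T, -, -, rfl⟩ := mem_tseitin.1 hC
    rw [toXor_vertexClause]
    exact XorClause.length_le ((card_litClause_le _ _).trans ((hd u).trans d.le_succ))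
      fun q hq => (card_le_of_mem_litClause q hq).trans hd1
  induction k with
  | zero =>
    intro A T hA hT hk
    rw [Finset.card_eq_zero, Finset.sdiff_eq_empty_iff_subset] at hk
    obtain rfl := Finset.Subset.antisymm hA hk
    have hl := hlen _ T subset_rfl
    -- With all edges at `v` fixed, the right parity makes the `⊕`-clause a tautology, and the wrong
    -- parity makes it a weakening of a clause of the formula.
    by_cases hTv : (T.card : ZMod 2) = c v
    · refine ⟨_, ?_, .weaken (.ax hC₀) fun a ha => ?_⟩
      · have := hax _ hC₀
        omega
      · have h1 := sum_eq_card_of_iff hT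
          (falsified_litClause.1 (ha.mono (Finset.subset_insert _ _)))
        exact absurd (h1.trans hTv) (ha (incident G v, c v) (Finset.mem_insert_self _ _))
    · have hC : vertexClause G v T ∈ tseitin G c := mem_tseitin.2 ⟨v, T, hT, hTv, rfl⟩
      refine ⟨_, ?_, .weaken (.ax hC) fun a ha => ?_⟩
      · have := hax _ hC
        omega
      · rw [toXor_vertexClause]
        exact ha.mono (Finset.subset_insert _ _)
  | succ k ih =>
    intro A T hA hT hk
    obtain ⟨e, he⟩ := Finset.card_pos.1 (by omega : 0 < (incident G v \ A).card)
    rw [Finset.mem_sdiff] at he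
    have heT : e ∉ T := fun h => he.2 (hT h)
    have hA' : insert e A ⊆ incident G v := Finset.insert_subset he.1 hA
    have hk' : (incident G v \ insert e A).card = k := by
      rw [Finset.sdiff_insert, Finset.card_erase_of_mem (Finset.mem_sdiff.2 he)]
      omega
    obtain ⟨s, hs, h1⟩ := ih (insert e A) (insert e T) hA' (Finset.insert_subset_insert _ hT) hk'
    obtain ⟨t, ht, h2⟩ := ih (insert e A) T hA' (hT.trans (Finset.subset_insert _ _)) hk'
    rw [litClause_insert_left, if_pos (Finset.mem_insert_self _ _), litClause_insert_right he.2,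
      Finset.insert_comm] at h1
    rw [litClause_insert_left, if_neg heT, Finset.insert_comm] at h2
    have h3 := TreeResXor.res h1 h2
    rw [Finset.union_self] at h3
    refine ⟨_, ?_, h3⟩
    have := hlen A T hA
    rw [pow_succ]
    nlinarith

/-- Tree-like `Res(⊕)` refutes Tseitin formulas by going through the vertices in order. -/
theorem exists_treeResXor (hd1 : 1 ≤ d) (hd : ∀ v, (incident G v).card ≤ d)
    (hc : ∑ v, c v = 1) :
    ∃ s, s ≤ (1 + (d + 1) * (d + 1)) + (1 + n * (d + 1)) +
        n * (3 * 2 ^ d * (1 + (d + 1) * (d + 1)) + (1 + n * (d + 1))) ∧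
      TreeResXor (tseitin G c) ∅ s := by
  obtain ⟨C₀, hC₀⟩ := exists_mem_tseitin (G := G) hc
  set ℓ := 1 + (d + 1) * (d + 1)
  set L := 1 + n * (d + 1)
  set M := 3 * 2 ^ d * ℓ
  have hL : ∀ i, XorClause.length (prefixClause G c i) ≤ L := fun i =>
    XorClause.length_le (card_prefixClause_le i) (card_le_of_mem_prefixClause hd i)
  -- Going down from `i = n`, where the clause is a tautology because not all constraints can hold,
  -- each step resolves once with the constraint at vertex `i`. The spine has length `n`.
  have key : ∀ k i, i + k = n → ∃ s, s ≤ ℓ + L + k * (M + L) ∧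
      TreeResXor (tseitin G c) (prefixClause G c i) s := by
    intro k
    induction k with
    | zero =>
      rintro i rfl
      refine ⟨_, ?_, .weaken (.ax hC₀) fun a ha => ?_⟩
      · have h1 : XorClause.length C₀.toXor ≤ ℓ := by
          obtain ⟨u, T, -, -, rfl⟩ := mem_tseitin.1 hC₀
          rw [toXor_vertexClause]
          exact XorClause.length_le ((card_litClause_le _ _).trans ((hd u).trans d.le_succ))
            fun q hq => (card_le_of_mem_litClause q hq).trans hd1
        have h2 := hL (i + 0)
        simp only [Nat.add_zero] at h2 ⊢
        omega
      · rw [falsified_prefixClause] at ha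
        obtain ⟨v, hv⟩ := exists_violated hc a
        exact absurd (ha v (by simp)) hv
    | succ k ih =>
      intro i hi
      obtain ⟨s, hs, h1⟩ := ih (i + 1) (by omega)
      let v : Fin n := ⟨i, by omega⟩
      obtain ⟨t, ht, h2⟩ := treeResXor_constraint hd1 hd hC₀ v _ ∅ ∅ (by simp) (by simp) rfl
      have ht' : t ≤ M := by
        refine (Nat.le_add_right _ _).trans (ht.trans ?_)
        refine Nat.mul_le_mul_right _ (Nat.mul_le_mul_left _ (Nat.pow_le_pow_right (by norm_num) ?_))
        simpa using hd v
      have h3 : prefixClause G c (i + 1) = insert (incident G v, c v + 1) (prefixClause G c i) :=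
        prefixClause_succ v
      have h4 : litClause (∅ : Finset G.edgeSet) ∅ = ∅ := by simp [litClause]
      rw [h3] at h1
      rw [h4] at h2
      have hbound : ∀ r, r ≤ s + t + L → r ≤ ℓ + L + (k + 1) * (M + L) := by
        intro r hr
        rw [Nat.add_mul, Nat.one_mul]
        omega
      rcases zmod_two_cases (c v) with hv | hv
      · rw [hv] at h1 h2
        have h5 := TreeResXor.res h2 h1
        rw [Finset.empty_union] at h5
        exact ⟨_, hbound _ (by have := hL i; omega), h5⟩
      · rw [hv] at h1 h2
        have h5 := TreeResXor.res h1 h2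
        rw [Finset.union_empty] at h5
        exact ⟨_, hbound _ (by have := hL i; omega), h5⟩
  obtain ⟨s, hs, h⟩ := key n 0 (by omega)
  have h0 : prefixClause G c 0 = ∅ := by simp [prefixClause]
  rw [h0] at h
  exact ⟨s, hs, h⟩

/-- Hitting(`⊕`) refutes Tseitin formulas by searching for the first vertex with a violated
constraint. -/
theorem exists_hittingXor (hd1 : 1 ≤ d) (hd : ∀ v, (incident G v).card ≤ d)
    (hc : ∑ v, c v = 1) :
    ∃ H : Finset (XorClause G.edgeSet),
      ∑ C ∈ H, XorClause.length C ≤ n * 2 ^ d * (1 + (n + d) * (d + 1)) ∧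
      IsHittingXorRefutation (tseitin G c) H := by
  -- Each `⊕`-clause is falsified exactly when `v` is the first violated vertex and `T` is the set
  -- of edges at `v` with value 1; these events partition the assignments.
  let H : Finset (XorClause G.edgeSet) := Finset.univ.biUnion fun v : Fin n =>
    ((incident G v).powerset.filter fun T => (T.card : ZMod 2) ≠ c v).image fun T =>
      prefixClause G c v ∪ litClause (incident G v) T
  have hH : ∀ C, C ∈ H ↔ ∃ v : Fin n, ∃ T ⊆ incident G v, (T.card : ZMod 2) ≠ c v ∧
      prefixClause G c v ∪ litClause (incident G v) T = C := by
    intro C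
    simp [H, and_assoc]
  refine ⟨H, ?_, ?_, ?_, ?_⟩
  · have h1 : H.card ≤ n * 2 ^ d := by
      refine Finset.card_biUnion_le.trans ((Finset.sum_le_card_nsmul _ _ (2 ^ d) ?_).trans
        (by simp))
      intro v _
      refine Finset.card_image_le.trans ((Finset.card_filter_le _ _).trans ?_)
      rw [Finset.card_powerset]
      exact Nat.pow_le_pow_right (by norm_num) (hd v)
    refine (Finset.sum_le_card_nsmul _ _ (1 + (n + d) * (d + 1)) ?_).trans
      (Nat.mul_le_mul_right _ h1)
    intro C hC
    obtain ⟨v, T, -, -, rfl⟩ := (hH C).1 hC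
    refine XorClause.length_le ((Finset.card_union_le _ _).trans (add_le_add
      (card_prefixClause_le _) ((card_litClause_le _ _).trans (hd v)))) fun q hq => ?_
    rcases Finset.mem_union.1 hq with hq | hq
    · exact card_le_of_mem_prefixClause hd _ q hq
    · exact (card_le_of_mem_litClause q hq).trans hd1
  · intro C hC D hD hCD a ⟨hCa, hDa⟩
    obtain ⟨v, T, hT, hTv, rfl⟩ := (hH C).1 hC
    obtain ⟨u, S, hS, hSu, rfl⟩ := (hH D).1 hD
    have hv := falsified_litClause.1 (hCa.mono Finset.subset_union_right)
    have hu := falsified_litClause.1 (hDa.mono Finset.subset_union_right)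
    have hv' := falsified_prefixClause.1 (hCa.mono Finset.subset_union_left)
    have hu' := falsified_prefixClause.1 (hDa.mono Finset.subset_union_left)
    rcases lt_trichotomy v u with h | rfl | h
    · exact hTv ((sum_eq_card_of_iff hT hv).symm.trans (hu' v h))
    · refine hCD ?_
      have : T = S := by
        ext e
        constructor
        · exact fun he => (hu e (hT he)).1 ((hv e (hT he)).2 he)
        · exact fun he => (hv e (hS he)).1 ((hu e (hS he)).2 he)
      rw [this]
    · exact hSu ((sum_eq_card_of_iff hS hu).symm.trans (hv' u h))
  · intro a
    have hne : (Finset.univ.filter fun v => ∑ e ∈ incident G v, a e ≠ c v).Nonempty := by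
      obtain ⟨v, hv⟩ := exists_violated hc a
      exact ⟨v, by simpa using hv⟩
    obtain ⟨v, hv, hmin⟩ := Finset.exists_min_image _ id hne
    have hT : (incident G v).filter (fun e => a e = 1) ⊆ incident G v := Finset.filter_subset _ _
    have hiff : ∀ e ∈ incident G v, (a e = 1 ↔ e ∈ (incident G v).filter fun e => a e = 1) :=
      fun e he => by simp [he]
    refine ⟨_, (hH _).2 ⟨v, _, hT, ?_, rfl⟩, ?_⟩
    · rw [← sum_eq_card_of_iff hT hiff]
      exact (Finset.mem_filter.1 hv).2
    · intro q hq
      rcases Finset.mem_union.1 hq with hq | hq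
      · refine falsified_prefixClause.2 (fun j hj => ?_) q hq
        by_contra hcon
        exact absurd (hmin j (by simpa using hcon)) (not_le.2 hj)
      · exact falsified_litClause.2 hiff q hq
  · intro C hC
    obtain ⟨v, T, hT, hTv, rfl⟩ := (hH C).1 hC
    refine ⟨_, mem_tseitin.2 ⟨v, T, hT, hTv, rfl⟩, ?_⟩
    rw [toXor_vertexClause]
    exact Finset.subset_union_right

end Upper

end PC

namespace PC

/-! ### Choice of the constants -/

section Size

variable {n : ℕ} {G : SimpleGraph (Fin n)}

theorem IsExpander.card_edgeSet_le {d : ℕ} {γ : ℝ}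
    (hG : IsExpander G (2 * d) γ) : Nat.card G.edgeSet ≤ n * d := by
  classical
  have h1 := G.sum_degrees_eq_twice_card_edges
  have h2 : ∑ v, G.degree v ≤ n * (2 * d) := by
    refine (Finset.sum_le_card_nsmul _ _ (2 * d) fun v _ => ?_).trans (by simp)
    convert hG.1 v
  rw [h1, SimpleGraph.edgeFinset_card, ← Nat.card_eq_fintype_card] at h2
  nlinarith

theorem two_rpow_le_exp {x : ℝ} (hx : 0 ≤ x) : (2 : ℝ) ^ x ≤ Real.exp x := by
  rw [← Real.exp_one_rpow]
  exact Real.rpow_le_rpow (by norm_num) (by linarith [Real.add_one_le_exp (1 : ℝ)]) hx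

theorem one_sub_pow_le_exp {x : ℝ} (hx : x ≤ 1) (b : ℕ) : (1 - x) ^ b ≤ Real.exp (-(b * x)) := by
  rw [← mul_neg, Real.exp_nat_mul]
  exact pow_le_pow_left₀ (by linarith) (by linarith [Real.add_one_le_exp (-x)]) b

theorem le_div_thirtySix {n : ℕ} (hn : 72 ≤ n) : (n : ℝ) / 72 ≤ ((n / 36 : ℕ) : ℝ) := by
  have : n ≤ 72 * (n / 36) := by omega
  have : (n : ℝ) ≤ 72 * ((n / 36 : ℕ) : ℝ) := by exact_mod_cast this
  linarith

theorem IsExpander.resolution_size [DecidableEq G.edgeSet] (hG : IsExpander G 28 (1 / 3))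
    {c : Fin n → ZMod 2} (hn : 1008 ≤ n) {s : ℕ} {π : Fin s → Clause G.edgeSet}
    (h : IsResRefutation (tseitin G c) π) : (2 : ℝ) ^ ((1 / 145152 : ℝ) * n) ≤ s := by
  classical
  by_contra! hs
  have hn' : (n : ℝ) / 72 ≤ ((n / 36 : ℕ) : ℝ) := le_div_thirtySix (by omega)
  refine hG.not_der_of_width_le (by norm_num) c (by rw [Fintype.card_fin]; omega)
    (w := 28 + n / 36 + n / 36) ?_ ?_
  · rw [Fintype.card_fin]
    have : 12 * (28 + n / 36 + n / 36) ≤ n := by omega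
    have : (12 : ℝ) * (28 + n / 36 + n / 36 : ℕ) ≤ n := by exact_mod_cast this
    linarith
  -- Maximum degree 28 gives at most 14n variables, and 2 · 14n / 2016 = n/72 is at most the width
  -- threshold `n / 36`. The exponent is 1/145152 = 1/(72 · 2016).
  · refine Der.width_of_size (N := n * 14) (q := 1 - 1 / 2016) (by norm_num) ?_ _ (n / 36) _ _
      Finset.univ rfl ?_ (by simp) (card_le_of_mem_tseitin hG) h.der ?_
    · push_cast
      linarith
    · rw [Finset.card_univ, ← Nat.card_eq_fintype_card]
      exact IsExpander.card_edgeSet_le (d := 14) hG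
    · have h1 : (fat (Finset.univ.image π) (n / 36)).card ≤ s :=
        (Finset.card_filter_le _ _).trans (Finset.card_image_le.trans (by simp))
      have h2 := two_rpow_le_exp (by positivity : 0 ≤ (1 / 145152 : ℝ) * n)
      calc _ ≤ (s : ℝ) * Real.exp (-((n / 36 : ℕ) * (1 / 2016))) := by
            gcongr
            exact one_sub_pow_le_exp (by norm_num) _
        _ ≤ (s : ℝ) * Real.exp (-((1 / 145152 : ℝ) * n)) := by
            refine mul_le_mul_of_nonneg_left (Real.exp_le_exp.2 ?_) (by positivity)
            linarith
        _ < Real.exp ((1 / 145152 : ℝ) * n) * Real.exp (-((1 / 145152 : ℝ) * n)) := by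
            gcongr
            linarith
        _ = 1 := by rw [← Real.exp_add, add_neg_cancel, Real.exp_zero]

theorem IsExpander.hitting_size [DecidableEq G.edgeSet] (hG : IsExpander G 28 (1 / 3))
    {c : Fin n → ZMod 2} (hn : 72 ^ 3 ≤ n) {H : CNF G.edgeSet}
    (h : IsHittingRefutation (tseitin G c) H) : (2 : ℝ) ^ ((n : ℝ) ^ (1 / 3 : ℝ)) ≤ H.card := by
  classical
  by_contra! hs
  have hn' : (n : ℝ) / 72 ≤ ((n / 36 : ℕ) : ℝ) := le_div_thirtySix (by omega)
  set t : ℝ := (n : ℝ) ^ (1 / 3 : ℝ)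
  have ht3 : t ^ 3 = n := by
    rw [← Real.rpow_natCast, ← Real.rpow_mul (by positivity)]
    norm_num
  have ht0 : 0 ≤ t := by positivity
  have ht : 72 ≤ t := by
    refine le_of_pow_le_pow_left₀ (n := 3) (by norm_num) ht0 ?_
    rw [ht3]
    exact_mod_cast hn
  set L : ℕ := ⌊t⌋₊
  have hLt : (L : ℝ) ≤ t := Nat.floor_le ht0
  have htL : t < ((L + 1 : ℕ) : ℝ) := by exact_mod_cast Nat.lt_floor_add_one t
  have hL1 : 1 ≤ L := Nat.le_floor (by push_cast; linarith)
  have hL1' : (1 : ℝ) ≤ L := by exact_mod_cast hL1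
  have hLinv : 1 / (L : ℝ) ≤ 1 := by rw [div_le_one (by linarith)]; exact hL1'
  refine hG.not_der_of_width_le (by norm_num) c (by rw [Fintype.card_fin]; omega)
    (w := 28 + n / 36) ?_ ?_
  · rw [Fintype.card_fin]
    have : 12 * (28 + n / 36) ≤ n := by omega
    have : (12 : ℝ) * (28 + n / 36 : ℕ) ≤ n := by exact_mod_cast this
    linarith
  · refine h.width (L := L) (q := 1 - 1 / L) (by linarith) ?_ _ (n / 36) _ _ rfl
      (card_le_of_mem_tseitin hG) ?_ ?_
    · rw [sub_sub_cancel, mul_one_div_cancel (by linarith)]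
    · have h1 : (2 : ℝ) ^ t ≤ (2 : ℝ) ^ ((L + 1 : ℕ) : ℝ) :=
        Real.rpow_le_rpow_of_exponent_le (by norm_num) htL.le
      rw [Real.rpow_natCast] at h1
      exact_mod_cast hs.trans_le h1
    -- Since `L ≤ t` and `t ≥ 72`, t · L ≤ t² ≤ t³/72 = n/72; the exponent 1/3 leaves room for the
    -- constants.
    · have h2 : t ≤ (n / 36 : ℕ) * (1 / (L : ℝ)) := by
        rw [mul_one_div, le_div_iff₀ (by linarith)]
        nlinarith [mul_le_mul_of_nonneg_left hLt ht0, sq_nonneg t]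
      have h3 := two_rpow_le_exp ht0
      calc ((H.card : ℝ) - 1) * (1 - 1 / (L : ℝ)) ^ (n / 36)
          ≤ (H.card : ℝ) * (1 - 1 / (L : ℝ)) ^ (n / 36) :=
            mul_le_mul_of_nonneg_right (by linarith) (pow_nonneg (by linarith) _)
        _ ≤ (H.card : ℝ) * Real.exp (-((n / 36 : ℕ) * (1 / (L : ℝ)))) := by
            gcongr
            exact one_sub_pow_le_exp hLinv _
        _ ≤ (H.card : ℝ) * Real.exp (-t) := by gcongr
        _ < Real.exp t * Real.exp (-t) := by gcongr; linarith
        _ = 1 := by rw [← Real.exp_add, add_neg_cancel, Real.exp_zero]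

end Size

end PC

theorem mainTheorem11 :
    ∃ (d : ℕ) (γ : ℝ) (G : (n : ℕ) → SimpleGraph (Fin n)) (c : (n : ℕ) → Fin n → ZMod 2),
      0 < γ ∧
      (∀ n, PC.IsExpander (G n) d γ) ∧
      (∀ n, 1 ≤ n → ∑ v, c n v = 1) ∧
      -- resolution refutations have size `2 ^ Ω(n)`
      (∃ δ : ℝ, 0 < δ ∧ ∀ᶠ n : ℕ in Filter.atTop,
        ∀ (s : ℕ) (π : Fin s → PC.Clause (G n).edgeSet),
          PC.IsResRefutation (PC.tseitin (G n) (c n)) π → (2 : ℝ) ^ (δ * (n : ℝ)) ≤ (s : ℝ)) ∧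
      -- Hitting refutations have size `2 ^ (n ^ Ω(1))`
      (∃ ε : ℝ, 0 < ε ∧ ∀ᶠ n : ℕ in Filter.atTop,
        ∀ H : PC.CNF (G n).edgeSet,
          PC.IsHittingRefutation (PC.tseitin (G n) (c n)) H →
            (2 : ℝ) ^ ((n : ℝ) ^ ε) ≤ (H.card : ℝ)) ∧
      -- there are tree-like `Res(⊕)` refutations of polynomial size
      (∃ p : Polynomial ℕ, ∀ n, 1 ≤ n → ∃ s : ℕ, s ≤ p.eval n ∧
        PC.TreeResXor (PC.tseitin (G n) (c n)) ∅ s) ∧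
      -- there are Hitting(`⊕`) refutations of polynomial size
      (∃ p : Polynomial ℕ, ∀ n, 1 ≤ n → ∃ H : Finset (PC.XorClause (G n).edgeSet),
        (∑ C ∈ H, PC.XorClause.length C) ≤ p.eval n ∧
        PC.IsHittingXorRefutation (PC.tseitin (G n) (c n)) H) := by
  choose G hG using PC.exists_isExpander
  have hc : ∀ n, 1 ≤ n → ∑ v : Fin n, (if v.val = 0 then 1 else 0 : ZMod 2) = 1 := by
    intro n hn
    rw [Finset.sum_eq_single ⟨0, hn⟩]
    · simp
    · intro v _ hv
      rw [if_neg fun h => hv (Fin.ext h)]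
    · simp
  have hd : ∀ n v, (PC.incident (G n) v).card ≤ 28 := fun n v =>
    (PC.card_incident_le (G n) v).trans ((hG n).1 v)
  refine ⟨28, 1 / 3, G, fun n v => if v.val = 0 then 1 else 0, by norm_num, hG, hc,
    ⟨1 / 145152, by norm_num, ?_⟩, ⟨1 / 3, by norm_num, ?_⟩,
    ⟨(1 + (28 + 1) * (28 + 1)) + (1 + Polynomial.X * (28 + 1)) + Polynomial.X *
      (3 * 2 ^ 28 * (1 + (28 + 1) * (28 + 1)) + (1 + Polynomial.X * (28 + 1))), ?_⟩,
    ⟨Polynomial.X * 2 ^ 28 * (1 + (Polynomial.X + 28) * (28 + 1)), ?_⟩⟩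
  · filter_upwards [Filter.eventually_ge_atTop 1008] with n hn s π h
    exact (hG n).resolution_size hn h
  · filter_upwards [Filter.eventually_ge_atTop (72 ^ 3)] with n hn H h
    exact (hG n).hitting_size hn h
  · intro n hn
    obtain ⟨s, hs, h⟩ := PC.exists_treeResXor (by norm_num) (hd n) (hc n hn)
    refine ⟨s, hs.trans (le_of_eq ?_), h⟩
    simp only [Polynomial.eval_add, Polynomial.eval_mul, Polynomial.eval_pow, Polynomial.eval_X,
      Polynomial.eval_one, Polynomial.eval_ofNat]
  · intro n hn
    obtain ⟨H, hH, h⟩ := PC.exists_hittingXor (by norm_num) (hd n) (hc n hn)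
    refine ⟨H, hH.trans (le_of_eq ?_), h⟩
    simp only [Polynomial.eval_add, Polynomial.eval_mul, Polynomial.eval_pow, Polynomial.eval_X,
      Polynomial.eval_one, Polynomial.eval_ofNat]
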